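/- There are universal constants $c_0, c > 0$ such that the following holds. Let $n \ge 1$ be the number of workers, and let $L, B, \varepsilon > 0$ and $\sigma, h, \tau \ge 0$ satisfy $\varepsilon \le c_0 L B^2$. Then there are a dimension $d$, a probability distribution $\mathcal{D}$, a function $f(x;\xi)$ that is differentiable in $x \in \mathbb{R}^d$, and points $x^0, x^* \in \mathbb{R}^d$ such that: (a) $f(x) := \mathbb{E}_{\xi \sim \mathcal{D}}[f(x;\xi)]$ is convex, differentiable and $L$-smooth, i.e. $\|\nabla f(x) - \nabla f(y)\| \le L \|x - y\|$ for all $x, y$; (b) $\mathbb{E}_{\xi}[\nabla f(x;\xi)] = \nabla f(x)$ and $\mathbb{E}_{\xi}[\|\nabla f(x;\xi) - \nabla f(x)\|^2] \le \sigma^2$ for all $x$; (c) $x^*$ is a minimizer of $f$ closest to $x^0$, and $\|x^0 - x^*\| = B$; and such that canonical Local SGD, run on this problem from $x^0$, has the following property. For a real step size $\eta$, numbers $K, R \ge 0$ and i.i.d. samples $\xi^t_{i,j} \sim \mathcal{D}$, the method is $$z^t_{i,0} = x^t, \qquad z^t_{i,j+1} = z^t_{i,j} - \eta \nabla f(z^t_{i,j};\xi^t_{i,j})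 \quad (0 \le j < K), \qquad x^{t+1} = \frac1n \sum_{i=1}^n z^t_{i,K} \quad (0 \le t < R).$$ For every choice of the parameters $\eta \in \mathbb{R}$, $R \ge 0$ and $K \ge 0$ with $K \ne 1$: if $x^R$ is an $\varepsilon$-solution, i.e. $\mathbb{E}[f(x^R)] - f(x^*) \le \varepsilon$, then the $R$ rounds take at least $$c \cdot \min\left\{\sqrt{\tau h\, \frac{L \sigma^2 B^4}{\varepsilon^3}} + h\left(\frac{L B^2}{\varepsilon} + \frac{\sigma^2 B^2}{n \varepsilon^2}\right),\; h\left(\frac{L B^2}{\varepsilon} + \frac{\sigma^2 B^2}{\varepsilon^2}\right)\right\}$$ seconds in the worst case over the following time model: computing one stochastic gradient takes a worker at most $h$ seconds, communicating at the end of a round takes at most $\tau$ seconds, and in every round the workers compute in parallel, each one its $K$ stochastic gradients one after the other, and then communicate. (The problem and the worst-case times do not depend on $\eta$, $K$, $R$.) -/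

import Mathlib

open MeasureTheory ProbabilityTheory

namespace LocalSGD

/-- `ℝ^d` with the Euclidean norm. -/
abbrev Vec (d : ℕ) : Type := EuclideanSpace ℝ (Fin d)

section Problem

variable {d : ℕ} {Ξ : Type} [MeasurableSpace Ξ]

/-- The objective `f(x) = 𝔼_{ξ ∼ D}[f(x; ξ)]`, where `F x ξ` stands for `f(x; ξ)`. -/
noncomputable def objective (D : Measure Ξ) (F : Vec d → Ξ → ℝ) (x : Vec d) : ℝ :=
  ∫ s, F x s ∂D

/-- The stochastic gradient `∇f(x; ξ)` (gradient in `x`). -/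
noncomputable def stochGrad (F : Vec d → Ξ → ℝ) (x : Vec d) (s : Ξ) : Vec d :=
  gradient (fun y => F y s) x

/-- `f` is differentiable and `L`-smooth. -/
structure IsLSmooth (f : Vec d → ℝ) (L : ℝ) : Prop where
  differentiable : Differentiable ℝ f
  lipschitz_grad : ∀ x y, ‖gradient f x - gradient f y‖ ≤ L * ‖x - y‖

/-- The stochastic gradients `∇f(x; ξ)`, `ξ ∼ D`, are well defined, unbiased estimators of the
gradient of the objective, with variance at most `σ ^ 2` at every point. -/
structure HasBoundedVariance (D : Measure Ξ) (F : Vec d → Ξ → ℝ) (σ : ℝ) : Prop where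
  differentiable : ∀ s, Differentiable ℝ (fun x => F x s)
  integrable : ∀ x, Integrable (F x) D
  measurable_grad : Measurable (fun p : Vec d × Ξ => stochGrad F p.1 p.2)
  integrable_grad : ∀ x, Integrable (stochGrad F x) D
  unbiased : ∀ x, ∫ s, stochGrad F x s ∂D = gradient (objective D F) x
  integrable_sq : ∀ x, Integrable (fun s => ‖stochGrad F x s - gradient (objective D F) x‖ ^ 2) D
  variance_le : ∀ x, ∫ s, ‖stochGrad F x s - gradient (objective D F) x‖ ^ 2 ∂D ≤ σ ^ 2

/-- `f` is convex, `xs` is a minimizer of `f` that is closest to `x0`, and `‖x0 - xs‖ = B`. -/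
structure IsConvexWithMin (f : Vec d → ℝ) (x0 xs : Vec d) (B : ℝ) : Prop where
  convex : ConvexOn ℝ Set.univ f
  isMin : ∀ y, f xs ≤ f y
  closest : ∀ ys, (∀ y, f ys ≤ f y) → ‖x0 - xs‖ ≤ ‖x0 - ys‖
  dist_eq : ‖x0 - xs‖ = B

end Problem

section Algorithm

variable {d n : ℕ} {Ξ : Type}

/-- Local iterates of one worker in one round: `z_0 = x`, `z_{j+1} = z_j - η ∇f(z_j; ξ_j)`. -/
def localIterate (η : ℝ) (g : Vec d → Ξ → Vec d) (s : ℕ → Ξ) (x : Vec d) : ℕ → Vec d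
  | 0 => x
  | j + 1 => localIterate η g s x j - η • g (localIterate η g s x j) (s j)

/-- Canonical Local SGD with `n` workers, step size `η`, and `K` local steps per round: the global
iterate `x^t` after `t` rounds, where `s t i j` is the sample `ξ^t_{i,j}`, and
`x^{t+1} = (1/n) ∑_i z^t_{i,K}`. -/
noncomputable def iterate (η : ℝ) (K : ℕ) (g : Vec d → Ξ → Vec d) (s : ℕ → Fin n → ℕ → Ξ)
    (x0 : Vec d) : ℕ → Vec d
  | 0 => x0
  | t + 1 => (1 / (n : ℝ)) • ∑ i, localIterate η g (s t i) (iterate η K g s x0 t) K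

/-- The samples `ξ^t_{i,j}` are independent with common distribution `D`. -/
structure IsIIDSample [MeasurableSpace Ξ] (D : Measure Ξ) {Ω : Type*} [MeasurableSpace Ω]
    (μ : Measure Ω) (ξ : ℕ → Fin n → ℕ → Ω → Ξ) : Prop where
  measurable : ∀ t i j, Measurable (ξ t i j)
  law : ∀ t i j, μ.map (ξ t i j) = D
  indep : iIndepFun (fun p : ℕ × Fin n × ℕ => ξ p.1 p.2.1 p.2.2) μ

/-- The random point `X` is an `ε`-solution: `𝔼[f(X)] - f(x*) ≤ ε`, the expectation being finite. -/
def IsEpsSolution {Ω : Type*} [MeasurableSpace Ω] (μ : Measure Ω) (f : Vec d → ℝ) (xs : Vec d)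
    (ε : ℝ) (X : Ω → Vec d) : Prop :=
  Integrable (fun ω => f (X ω)) μ ∧ (∫ ω, f (X ω) ∂μ) - f xs ≤ ε

end Algorithm

/-- Computation and communication times: `comp t i j` is the time worker `i` needs for its `j`-th
stochastic gradient in round `t`, at most `h`; `comm t` is the time of the communication that
ends round `t`, at most `τ`. -/
structure Timing (n : ℕ) (h τ : ℝ) where
  comp : ℕ → Fin n → ℕ → ℝ
  comm : ℕ → ℝ
  comp_nonneg : ∀ t i j, 0 ≤ comp t i j
  comp_le : ∀ t i j, comp t i j ≤ h
  comm_nonneg : ∀ t, 0 ≤ comm t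
  comm_le : ∀ t, comm t ≤ τ

/-- Time of `R` rounds of Local SGD with `K` local steps: in every round the workers compute in
parallel, each one its `K` stochastic gradients one after the other, and then communicate. -/
noncomputable def Timing.runTime {n : ℕ} {h τ : ℝ} (S : Timing n h τ) (K R : ℕ) : ℝ :=
  ∑ t ∈ Finset.range R, ((⨆ i : Fin n, ∑ j ∈ Finset.range K, S.comp t i j) + S.comm t)

end LocalSGD

/-! The hard objective is a separable sum over three coordinates with minimum value 0 at the origin.
Each summand is nonnegative, so an `ε`-solution must be accurate in every coordinate, and each
coordinate constrains `η`, `K`, `R` in its own way.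

The stiff coordinate, of curvature `L` and without noise, diverges or stalls unless `0 < η` and `η *
L < 2` (`stepSize_bounds`). The flat coordinate, of curvature `16 * ε / B ^ 2`, is linear, so
averaging commutes with local steps and it behaves like `R * K` steps with noise variance divided by
`n`. Its bias forces `B ^ 2 ≲ η * ε * R * K`, its variance `η * σ ^ 2 ≲ n * ε`
(`steps_bounds_of_flatMoment`).

The skew coordinate carries the cost of local steps. Its curvature is larger on the left than on the
right, so one noisy step acts on the mean by `m ↦ (1 - 3/4 P) m + (P/4) 𝔼|z|` with `P = η * L / 4`:
noise pushes every worker to the right, and averaging over workers does not cancel a common bias.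
Between averagings `𝔼|z|` grows like `η σ √j`, so the mean reaches order `η σ √K` if `P * K ≤ 1`,
and `η σ / √P` from the last `1 / P` local steps otherwise. Accuracy then gives `L * (η * σ) ^ 2 * K
≲ ε` or `η * σ ^ 2 ≲ ε` (`rounds_bounds_of_skew`).

Eliminating `η` bounds `R * K` and either `K * R ^ 2` or, without the factor `n`, `R * K` again. The
worst-case time is `R * (K * h + τ)`, and a product inequality between its two summands produces the
square root (`time_ge`). -/

namespace LocalSGD

/-! ### Coin-flip noise -/

/-- The sign `±1` encoded by a Boolean. -/
def boolSign (s : Bool) : ℝ := if s then 1 else -1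

/-- The uniform distribution on `Bool`. -/
noncomputable def fairCoin : Measure Bool := (PMF.uniformOfFintype Bool).toMeasure

instance : IsProbabilityMeasure fairCoin := by
  unfold fairCoin; infer_instance

lemma integral_fairCoin {E : Type*} [NormedAddCommGroup E] [NormedSpace ℝ E] [CompleteSpace E]
    (f : Bool → E) : ∫ s, f s ∂fairCoin = (1 / 2 : ℝ) • (f true + f false) := by
  simp [fairCoin, PMF.integral_eq_sum, smul_add]

lemma integral_boolSign : ∫ s, boolSign s ∂fairCoin = 0 := by
  simp [integral_fairCoin, boolSign]

lemma boolSign_sq (s : Bool) : boolSign s ^ 2 = 1 := by cases s <;> simp [boolSign]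

/-! ### The skew potential -/

/-- The convex potential with derivative `u ↦ (3 u - |u|) / 4`, whose curvature is `1` on the left
and `1 / 2` on the right of its minimizer `0`. -/
noncomputable def skewPotential (u : ℝ) : ℝ := 3 / 8 * u ^ 2 - 1 / 8 * (u * |u|)

/-- The derivative of `skewPotential`. -/
noncomputable def skewForce (u : ℝ) : ℝ := 3 / 4 * u - 1 / 4 * |u|

lemma hasDerivAt_mul_abs (u : ℝ) : HasDerivAt (fun v : ℝ => v * |v|) (2 * |u|) u := by
  rcases lt_trichotomy u 0 with hu | hu | hu
  · have h : HasDerivAt (fun v : ℝ => -(v ^ 2)) (2 * |u|) u := by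
      refine (hasDerivAt_pow 2 u).neg.congr_deriv ?_
      rw [abs_of_neg hu]; norm_num
    refine h.congr_of_eventuallyEq ?_
    filter_upwards [gt_mem_nhds hu] with v hv
    rw [abs_of_neg hv]; ring
  · subst hu
    rw [hasDerivAt_iff_tendsto_slope]
    have h : Filter.Tendsto (fun v : ℝ => |v|) (nhdsWithin 0 {0}ᶜ) (nhds (2 * |0|)) := by
      have := (continuous_abs (G := ℝ)).tendsto 0
      simp only [abs_zero, mul_zero] at this ⊢
      exact this.mono_left nhdsWithin_le_nhds
    refine h.congr' ?_
    filter_upwards [self_mem_nhdsWithin] with v hv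
    have hv : v ≠ 0 := hv
    simp [slope, hv]
  · have h : HasDerivAt (fun v : ℝ => v ^ 2) (2 * |u|) u := by
      refine (hasDerivAt_pow 2 u).congr_deriv ?_
      rw [abs_of_pos hu]; norm_num
    refine h.congr_of_eventuallyEq ?_
    filter_upwards [lt_mem_nhds hu] with v hv
    rw [abs_of_pos hv]; ring

lemma hasDerivAt_skewPotential (u : ℝ) : HasDerivAt skewPotential (skewForce u) u := by
  refine (((hasDerivAt_pow 2 u).const_mul (3 / 8)).sub
    ((hasDerivAt_mul_abs u).const_mul (1 / 8))).congr_deriv ?_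
  unfold skewForce
  norm_num; ring

lemma sq_le_skewPotential (u : ℝ) : u ^ 2 / 4 ≤ skewPotential u := by
  unfold skewPotential
  nlinarith [le_abs_self u, abs_nonneg u, abs_mul_abs_self u]

lemma abs_skewForce_sub_le (u v : ℝ) : |skewForce u - skewForce v| ≤ |u - v| := by
  have h := abs_abs_sub_abs_le u v
  have h1 : skewForce u - skewForce v = 3 / 4 * (u - v) - 1 / 4 * (|u| - |v|) := by
    unfold skewForce; ring
  rw [h1]
  refine (abs_sub _ _).trans ?_
  rw [abs_mul, abs_mul, abs_of_pos (by norm_num : (0 : ℝ) < 3 / 4),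
    abs_of_pos (by norm_num : (0 : ℝ) < 1 / 4)]
  linarith

lemma abs_skewForce_le (u : ℝ) : |skewForce u| ≤ |u| := by
  simpa [skewForce] using abs_skewForce_sub_le u 0

lemma continuous_skewForce : Continuous skewForce := by
  unfold skewForce; fun_prop

lemma monotone_skewForce : Monotone skewForce := by
  intro u v huv
  have h := (abs_le.1 (abs_abs_sub_abs_le v u)).2
  rw [abs_of_nonneg (sub_nonneg.2 huv)] at h
  unfold skewForce
  linarith

lemma convexOn_skewPotential : ConvexOn ℝ Set.univ skewPotential := by
  have hd : deriv skewPotential = skewForce := funext fun u => (hasDerivAt_skewPotential u).deriv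
  refine Monotone.convexOn_univ_of_deriv (fun u => (hasDerivAt_skewPotential u).differentiableAt) ?_
  rw [hd]; exact monotone_skewForce

/-! ### The hard instance: gradients, smoothness, variance, minimizer -/

lemma hasGradientAt_separable {u₀ u₁ u₂ : ℝ → ℝ} {a₀ a₁ a₂ : ℝ} {x : Vec 3}
    (h₀ : HasDerivAt u₀ a₀ (x 0)) (h₁ : HasDerivAt u₁ a₁ (x 1)) (h₂ : HasDerivAt u₂ a₂ (x 2)) :
    HasGradientAt (fun y : Vec 3 => u₀ (y 0) + u₁ (y 1) + u₂ (y 2)) (!₂[a₀, a₁, a₂] : Vec 3) x := by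
  rw [hasGradientAt_iff_hasFDerivAt]
  have p (i : Fin 3) : HasFDerivAt (fun y : Vec 3 => y i)
      (EuclideanSpace.proj (𝕜 := ℝ) i : Vec 3 →L[ℝ] ℝ) x :=
    (EuclideanSpace.proj (𝕜 := ℝ) i : Vec 3 →L[ℝ] ℝ).hasFDerivAt
  refine (((h₀.comp_hasFDerivAt x (p 0)).add (h₁.comp_hasFDerivAt x (p 1))).add
    (h₂.comp_hasFDerivAt x (p 2))).congr_fderiv ?_
  ext v
  simp [Fin.sum_univ_three, PiLp.inner_apply, mul_comm]

/-- The hard instance: a stiff noiseless quadratic, a flat noisy quadratic, and a noisy skew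
potential, in three separate coordinates. -/
noncomputable def hardLoss (L l r : ℝ) (x : Vec 3) (s : Bool) : ℝ :=
  L / 2 * x 0 ^ 2 + (l / 2 * x 1 ^ 2 + r * boolSign s * x 1)
    + (L / 4 * skewPotential (x 2) + r * boolSign s * x 2)

/-- The expectation of `hardLoss`. -/
noncomputable def hardObjective (L l : ℝ) (x : Vec 3) : ℝ :=
  L / 2 * x 0 ^ 2 + l / 2 * x 1 ^ 2 + L / 4 * skewPotential (x 2)

/-- The gradient of `hardObjective`. -/
noncomputable def hardGradient (L l : ℝ) (x : Vec 3) : Vec 3 :=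
  !₂[L * x 0, l * x 1, L / 4 * skewForce (x 2)]

variable (L l r : ℝ)

lemma objective_hardLoss : objective fairCoin (hardLoss L l r) = hardObjective L l := by
  funext x
  simp only [objective, integral_fairCoin, hardLoss, hardObjective, boolSign, smul_eq_mul]
  norm_num; ring

lemma hasDerivAt_half_sq (a u : ℝ) : HasDerivAt (fun v : ℝ => a / 2 * v ^ 2) (a * u) u := by
  refine ((hasDerivAt_pow 2 u).const_mul (a / 2)).congr_deriv ?_
  norm_num; ring

lemma hasGradientAt_hardLoss (x : Vec 3) (s : Bool) :
    HasGradientAt (fun y => hardLoss L l r y s)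
      (!₂[L * x 0, l * x 1 + r * boolSign s, L / 4 * skewForce (x 2) + r * boolSign s] : Vec 3)
      x := by
  have hlin (u : ℝ) : HasDerivAt (fun v : ℝ => r * boolSign s * v) (r * boolSign s) u := by
    simpa using (hasDerivAt_id u).const_mul (r * boolSign s)
  exact hasGradientAt_separable (u₀ := fun v => L / 2 * v ^ 2)
    (u₁ := fun v => l / 2 * v ^ 2 + r * boolSign s * v)
    (u₂ := fun v => L / 4 * skewPotential v + r * boolSign s * v)
    (hasDerivAt_half_sq L _)
    ((hasDerivAt_half_sq l _).add (hlin _))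
    (((hasDerivAt_skewPotential _).const_mul (L / 4)).add (hlin _))

lemma hasGradientAt_hardObjective (x : Vec 3) :
    HasGradientAt (hardObjective L l) (hardGradient L l x) x :=
  hasGradientAt_separable (hasDerivAt_half_sq L _) (hasDerivAt_half_sq l _)
    ((hasDerivAt_skewPotential _).const_mul (L / 4))

lemma gradient_hardObjective (x : Vec 3) :
    gradient (hardObjective L l) x = hardGradient L l x :=
  (hasGradientAt_hardObjective L l x).gradient

lemma stochGrad_hardLoss (x : Vec 3) (s : Bool) :
    stochGrad (hardLoss L l r) x s =
      !₂[L * x 0, l * x 1 + r * boolSign s, L / 4 * skewForce (x 2) + r * boolSign s] :=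
  (hasGradientAt_hardLoss L l r x s).gradient

variable {L l r}

lemma isLSmooth_hardObjective (hl : 0 ≤ l) (hlL : l ≤ L) : IsLSmooth (hardObjective L l) L := by
  refine ⟨fun x => (hasGradientAt_hardObjective L l x).differentiableAt, fun x y => ?_⟩
  have hL : 0 ≤ L := hl.trans hlL
  rw [gradient_hardObjective, gradient_hardObjective]
  refine le_of_sq_le_sq ?_ (by positivity)
  rw [mul_pow, EuclideanSpace.real_norm_sq_eq, EuclideanSpace.real_norm_sq_eq]
  simp only [Fin.sum_univ_three, hardGradient, PiLp.sub_apply]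
  simp only [Matrix.cons_val]
  have h1 : (l * x 1 - l * y 1) ^ 2 ≤ L ^ 2 * (x 1 - y 1) ^ 2 := by
    rw [← mul_sub, mul_pow]; gcongr
  have h2 : (L / 4 * skewForce (x 2) - L / 4 * skewForce (y 2)) ^ 2 ≤ L ^ 2 * (x 2 - y 2) ^ 2 := by
    rw [← mul_sub, mul_pow]
    have h3 := sq_le_sq.2 (abs_skewForce_sub_le (x 2) (y 2))
    have h4 : (L / 4) ^ 2 ≤ L ^ 2 := by gcongr; linarith
    gcongr
  nlinarith

lemma hasBoundedVariance_hardLoss {σ : ℝ} (hr : 2 * r ^ 2 ≤ σ ^ 2) :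
    HasBoundedVariance fairCoin (hardLoss L l r) σ := by
  have hdiff (x : Vec 3) (s : Bool) : ‖stochGrad (hardLoss L l r) x s
      - gradient (objective fairCoin (hardLoss L l r)) x‖ ^ 2 = 2 * r ^ 2 := by
    rw [objective_hardLoss, gradient_hardObjective, stochGrad_hardLoss,
      EuclideanSpace.real_norm_sq_eq]
    simp only [Fin.sum_univ_three, hardGradient, PiLp.sub_apply, Matrix.cons_val]
    have := boolSign_sq s
    -- Both noisy coordinates share one coin of amplitude `r`, which gives `r ^ 2` each at every
    -- point.
    linear_combination (2 * r ^ 2) * this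
  refine ⟨fun s x => (hasGradientAt_hardLoss L l r x s).differentiableAt,
    fun x => .of_finite, ?_, fun x => .of_finite, fun x => ?_, fun x => .of_finite, fun x => ?_⟩
  · have hs : Measurable fun p : Vec 3 × Bool => boolSign p.2 :=
      (measurable_of_finite boolSign).comp measurable_snd
    have hc (i : Fin 3) : Measurable fun p : Vec 3 × Bool => p.1 i :=
      (by fun_prop : Continuous fun p : Vec 3 × Bool => p.1 i).measurable
    simp only [stochGrad_hardLoss]
    refine (WithLp.measurable_toLp _ _).comp (measurable_pi_lambda _ fun i => ?_)
    fin_cases i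
    · exact (hc 0).const_mul L
    · exact ((hc 1).const_mul l).add (hs.const_mul r)
    · exact ((continuous_skewForce.measurable.comp (hc 2)).const_mul (L / 4)).add (hs.const_mul r)
  · rw [objective_hardLoss, gradient_hardObjective, integral_fairCoin, stochGrad_hardLoss,
      stochGrad_hardLoss]
    ext i
    fin_cases i <;> simp [hardGradient, boolSign] <;> ring
  · simpa only [hdiff, integral_const, probReal_univ, one_smul] using hr

lemma convexOn_hardObjective (hL : 0 ≤ L) (hl : 0 ≤ l) :
    ConvexOn ℝ Set.univ (hardObjective L l) := by
  have hsq : ConvexOn ℝ Set.univ fun u : ℝ => u ^ 2 := Even.convexOn_pow even_two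
  have h (i : Fin 3) {u : ℝ → ℝ} (hu : ConvexOn ℝ Set.univ u) :
      ConvexOn ℝ Set.univ fun x : Vec 3 => u (x i) :=
    hu.comp_linearMap (EuclideanSpace.proj (𝕜 := ℝ) i : Vec 3 →L[ℝ] ℝ).toLinearMap
  exact (((h 0 hsq).smul (by positivity : 0 ≤ L / 2)).add
    ((h 1 hsq).smul (by positivity : 0 ≤ l / 2))).add
    ((h 2 convexOn_skewPotential).smul (by positivity : 0 ≤ L / 4))

lemma skewPotential_nonneg (u : ℝ) : 0 ≤ skewPotential u :=
  le_trans (by positivity) (sq_le_skewPotential u)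

lemma hardObjective_zero : hardObjective L l 0 = 0 := by
  simp [hardObjective, skewPotential]

lemma hardObjective_nonneg (hL : 0 ≤ L) (hl : 0 ≤ l) (x : Vec 3) : 0 ≤ hardObjective L l x := by
  have := skewPotential_nonneg (x 2)
  unfold hardObjective; positivity

/-- The starting point of the hard instance. -/
noncomputable def hardStart (B : ℝ) : Vec 3 := !₂[3 / 5 * B, 4 / 5 * B, 0]

lemma isConvexWithMin_hardObjective {B : ℝ} (hL : 0 < L) (hl : 0 < l) (hB : 0 ≤ B) :
    IsConvexWithMin (hardObjective L l) (hardStart B) 0 B := by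
  refine ⟨convexOn_hardObjective hL.le hl.le, fun y => ?_, fun ys h => ?_, ?_⟩
  · rw [hardObjective_zero]; exact hardObjective_nonneg hL.le hl.le y
  · suffices h0 : ys = 0 by rw [h0]
    have h1 := h 0
    rw [hardObjective_zero, hardObjective] at h1
    have h2 := sq_le_skewPotential (ys 2)
    have a0 : 0 ≤ L / 2 * ys 0 ^ 2 := by positivity
    have a1 : 0 ≤ l / 2 * ys 1 ^ 2 := by positivity
    have a2 : 0 ≤ ys 2 ^ 2 := by positivity
    have a3 : 0 ≤ L / 4 * skewPotential (ys 2) := mul_nonneg (by positivity) (by linarith)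
    have b0 : L / 2 * ys 0 ^ 2 = 0 := by linarith
    have b1 : l / 2 * ys 1 ^ 2 = 0 := by linarith
    have b2 : L / 4 * skewPotential (ys 2) = 0 := by linarith
    have b3 : skewPotential (ys 2) = 0 := by
      rcases mul_eq_zero.1 b2 with h | h
      · linarith
      · exact h
    have c0 : ys 0 = 0 := by
      rcases mul_eq_zero.1 b0 with h | h
      · linarith
      · exact pow_eq_zero_iff two_ne_zero |>.1 h
    have c1 : ys 1 = 0 := by
      rcases mul_eq_zero.1 b1 with h | h
      · linarith
      · exact pow_eq_zero_iff two_ne_zero |>.1 h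
    have c2 : ys 2 = 0 := pow_eq_zero_iff two_ne_zero |>.1 (by linarith)
    ext i
    fin_cases i
    · exact c0
    · exact c1
    · exact c2
  · rw [sub_zero, EuclideanSpace.norm_eq]
    simp only [hardStart, Fin.sum_univ_three, Matrix.cons_val, Real.norm_eq_abs,
      sq_abs]
    rw [← Real.sqrt_sq hB]
    congr 1
    rw [Real.sqrt_sq hB]
    -- The starting point uses the 3-4-5 triangle: `(3/5) ^ 2 + (4/5) ^ 2 = 1`.
    ring

/-! ### Functions of finitely many coin flips -/

/-- `W` is a function of the samples `X i`, `i ∈ S`. -/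
def DependsOnSamples {ι Ω α : Type*} (X : ι → Ω → Bool) (S : Finset ι) (W : Ω → α) : Prop :=
  ∃ g : (S → Bool) → α, ∀ ω, W ω = g fun i => X i ω

namespace DependsOnSamples

variable {ι Ω α β γ : Type*} {X : ι → Ω → Bool} {S T : Finset ι}

lemma const (a : α) : DependsOnSamples X S fun _ => a := ⟨fun _ => a, fun _ => rfl⟩

lemma sample {i : ι} (hi : i ∈ S) : DependsOnSamples X S (X i) :=
  ⟨fun s => s ⟨i, hi⟩, fun _ => rfl⟩

lemma comp {W : Ω → α} (hW : DependsOnSamples X S W) (f : α → β) :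
    DependsOnSamples X S fun ω => f (W ω) := by
  obtain ⟨g, hg⟩ := hW
  exact ⟨fun s => f (g s), fun ω => by simp only [hg]⟩

lemma comp₂ {V : Ω → α} {W : Ω → β} (hV : DependsOnSamples X S V) (hW : DependsOnSamples X S W)
    (f : α → β → γ) : DependsOnSamples X S fun ω => f (V ω) (W ω) := by
  obtain ⟨g, hg⟩ := hV
  obtain ⟨g', hg'⟩ := hW
  exact ⟨fun s => f (g s) (g' s), fun ω => by simp only [hg, hg']⟩

lemma mono {W : Ω → α} (hW : DependsOnSamples X S W) (h : S ⊆ T) : DependsOnSamples X T W := by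
  obtain ⟨g, hg⟩ := hW
  exact ⟨fun s => g fun i => s ⟨i, h i.2⟩, hg⟩

lemma sum [AddCommMonoid α] {κ : Type*} {A : Finset κ} {W : κ → Ω → α}
    (hW : ∀ k ∈ A, DependsOnSamples X S (W k)) : DependsOnSamples X S fun ω => ∑ k ∈ A, W k ω := by
  classical
  induction A using Finset.induction_on with
  | empty => simpa using const 0
  | insert a A ha ih =>
    simp only [Finset.sum_insert ha]
    exact (hW a (A.mem_insert_self a)).comp₂
      (ih fun k hk => hW k (Finset.mem_insert_of_mem hk)) (· + ·)

variable [MeasurableSpace Ω] {μ : Measure Ω}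

/-- Finitely many coins take finitely many values, so any such function is measurable and bounded,
whatever `g` is. This settles every integrability question below. -/
lemma integrable [IsFiniteMeasure μ] (hX : ∀ i, Measurable (X i)) {W : Ω → ℝ}
    (hW : DependsOnSamples X S W) : Integrable W μ := by
  obtain ⟨g, hg⟩ := hW
  have hm : Measurable fun ω => (fun i : S => X i ω) := measurable_pi_lambda _ fun i => hX i
  rw [funext hg]
  exact (Integrable.of_finite (μ := μ.map _) (f := g)).comp_measurable hm

lemma integral_mul_boolSign [IsProbabilityMeasure μ] (hX : ∀ i, Measurable (X i))
    (hlaw : ∀ i, μ.map (X i) = fairCoin) (hind : iIndepFun X μ) {W : Ω → ℝ}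
    (hW : DependsOnSamples X S W) {p : ι} (hp : p ∉ S) :
    ∫ ω, W ω * boolSign (X p ω) ∂μ = 0 := by
  have hWi := hW.integrable (μ := μ) hX
  obtain ⟨g, hg⟩ := hW
  have h := (hind.indepFun_finset S {p} (Finset.disjoint_singleton_right.2 hp) hX).comp
    (measurable_of_finite g)
    (measurable_of_finite fun s : ({p} : Finset ι) → Bool =>
      boolSign (s ⟨p, Finset.mem_singleton_self p⟩))
  have h' : IndepFun W (fun ω => boolSign (X p ω)) μ := by rw [funext hg]; exact h
  have hs : Measurable fun ω => boolSign (X p ω) := (measurable_of_finite boolSign).comp (hX p)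
  rw [h'.integral_fun_mul_eq_mul_integral hWi.aestronglyMeasurable hs.aestronglyMeasurable,
    ← integral_map (f := boolSign) (hX p).aemeasurable
      (measurable_of_finite boolSign).aestronglyMeasurable, hlaw, integral_boolSign, mul_zero]

end DependsOnSamples

/-! ### Spread of a random walk and of the skew iterates -/

/-- From `cos x ^ 2 ≤ 1 / (1 + x ^ 2)` and Bernoulli's `(1 + 1 / J) ^ J ≥ 2`, the square of the left
side is at most `1 / 2`, below `9 / 16`. -/
lemma cos_pow_inv_sqrt_le {J : ℕ} (hJ : 0 < J) : Real.cos (1 / √J) ^ J ≤ 3 / 4 := by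
  have hJ' : (1 : ℝ) ≤ J := by exact_mod_cast hJ
  have h1 : 1 / √(J : ℝ) ≤ 1 := by
    rw [div_le_one (by positivity)]; exact Real.one_le_sqrt.2 hJ'
  have h0 : 0 ≤ 1 / √(J : ℝ) := by positivity
  have hpi := Real.pi_gt_three
  have hc0 : 0 ≤ Real.cos (1 / √J) := Real.cos_nonneg_of_mem_Icc ⟨by linarith, by linarith⟩
  have hc : Real.cos (1 / √J) ^ 2 * (1 + 1 / J) ≤ 1 := by
    have := Real.cos_le_one_div_sqrt_sq_add_one (x := 1 / √J) (by linarith) (by linarith)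
    have h2 : Real.cos (1 / √J) ^ 2 ≤ (1 / √((1 / √J) ^ 2 + 1)) ^ 2 := by gcongr
    rw [div_pow, Real.sq_sqrt (by positivity), div_pow, Real.sq_sqrt (by positivity)] at h2
    rw [le_div_iff₀ (by positivity)] at h2
    linarith
  have h2 : (2 : ℝ) ≤ (1 + 1 / (J : ℝ)) ^ J := by
    have := one_add_mul_le_pow (a := 1 / (J : ℝ)) (by linarith [show (0 : ℝ) ≤ 1 / J by positivity]) J
    rw [mul_one_div_cancel (by positivity)] at this
    linarith
  have h3 : (Real.cos (1 / √J) ^ J) ^ 2 * (1 + 1 / J) ^ J ≤ 1 := by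
    rw [← pow_mul, mul_comm J 2, pow_mul, ← mul_pow]
    exact pow_le_one₀ (by positivity) hc
  have h4 : 0 ≤ Real.cos (1 / √J) ^ J := by positivity
  nlinarith [sq_nonneg (Real.cos (1 / √J) ^ J)]

section Walk

variable {ι Ω : Type*} {X : ι → Ω → Bool} {T : ℕ → Finset ι} {p : ℕ → ι} {P δ : ℝ} {W : Ω → ℝ}

lemma dependsOnSamples_walk (hT : ∀ j, T j ⊆ T (j + 1)) (hp : ∀ j, p j ∈ T (j + 1))
    (hW : DependsOnSamples X (T 0) W) (δ : ℝ) (J : ℕ) :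
    DependsOnSamples X (T J)
      fun ω => W ω - δ * ∑ j ∈ Finset.range J, boolSign (X (p j) ω) := by
  refine (hW.mono (monotone_nat_of_le_succ hT J.zero_le)).comp₂
    (.sum (W := fun j ω => boolSign (X (p j) ω)) fun j hj => ?_) fun a b => a - δ * b
  exact (DependsOnSamples.sample
    (monotone_nat_of_le_succ hT (Finset.mem_range.1 hj) (hp j))).comp boolSign

/-- The iterates of noisy gradient steps on `skewPotential` started at `W`. -/
noncomputable def skewIterate (P δ : ℝ) (s : ℕ → ℝ) (w : ℝ) : ℕ → ℝ
  | 0 => w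
  | j + 1 => skewIterate P δ s w j - P * skewForce (skewIterate P δ s w j) - δ * s j

lemma dependsOnSamples_skewIterate (hT : ∀ j, T j ⊆ T (j + 1)) (hp : ∀ j, p j ∈ T (j + 1))
    (hW : DependsOnSamples X (T 0) W) (J : ℕ) :
    DependsOnSamples X (T J)
      fun ω => skewIterate P δ (fun j => boolSign (X (p j) ω)) (W ω) J := by
  induction J with
  | zero => exact hW
  | succ J ih =>
    exact (ih.mono (hT J)).comp₂ ((DependsOnSamples.sample (hp J)).comp boolSign)
      fun z b => z - P * skewForce z - δ * b

/-- Unrolling the recursion, the free walk is the iterate plus `P` times the accumulated forces, and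
each force is at most the distance to `0`. Hence the iterates cannot all be small when the walk is
large. -/
lemma abs_walk_le_skewIterate (hP : 0 ≤ P) (s : ℕ → ℝ) (w : ℝ) (J : ℕ) :
    |w - δ * ∑ j ∈ Finset.range J, s j|
      ≤ |skewIterate P δ s w J| + P * ∑ j ∈ Finset.range J, |skewIterate P δ s w j| := by
  have h : w - δ * ∑ j ∈ Finset.range J, s j
      = skewIterate P δ s w J + P * ∑ j ∈ Finset.range J, skewForce (skewIterate P δ s w j) := by
    induction J with
    | zero => simp [skewIterate]
    | succ J ih =>
      rw [Finset.sum_range_succ, Finset.sum_range_succ, skewIterate]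
      linear_combination ih
  rw [h]
  refine (abs_add_le _ _).trans ?_
  rw [abs_mul, abs_of_nonneg hP]
  gcongr
  exact (Finset.abs_sum_le_sum_abs _ _).trans (Finset.sum_le_sum fun j _ => abs_skewForce_le _)

variable [MeasurableSpace Ω] {μ : Measure Ω} [IsProbabilityMeasure μ]

/-- This is the characteristic function of the walk. In the addition formula a sign leaves `cos c`
alone and comes out of `sin c`, so the sine term has mean zero by independence of the new coin. -/
lemma integral_cos_walk (hX : ∀ i, Measurable (X i)) (hlaw : ∀ i, μ.map (X i) = fairCoin)
    (hind : iIndepFun X μ) (hT : ∀ j, T j ⊆ T (j + 1)) (hp : ∀ j, p j ∈ T (j + 1))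
    (hp' : ∀ j, p j ∉ T j) (hW : DependsOnSamples X (T 0) W) (c : ℝ) (J : ℕ) :
    ∫ ω, Real.cos (W ω - c * ∑ j ∈ Finset.range J, boolSign (X (p j) ω)) ∂μ
      = Real.cos c ^ J * ∫ ω, Real.cos (W ω) ∂μ := by
  induction J with
  | zero => simp
  | succ J ih =>
    have hdep := dependsOnSamples_walk hT hp hW c J
    have hpt (ω : Ω) : Real.cos (W ω - c * ∑ j ∈ Finset.range (J + 1), boolSign (X (p j) ω))
        = Real.cos c * Real.cos (W ω - c * ∑ j ∈ Finset.range J, boolSign (X (p j) ω))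
          + Real.sin c * (Real.sin (W ω - c * ∑ j ∈ Finset.range J, boolSign (X (p j) ω))
            * boolSign (X (p J) ω)) := by
      rw [Finset.sum_range_succ, mul_add, ← sub_sub, Real.cos_sub]
      cases X (p J) ω <;> simp [boolSign] <;> ring
    have hs := (hdep.comp Real.sin).integral_mul_boolSign hX hlaw hind (hp' J)
    have hi := ((hdep.mono (hT J)).comp₂ ((DependsOnSamples.sample (hp J)).comp boolSign)
      (fun a b => Real.sin a * b)).integrable (μ := μ) hX
    simp only [hpt]
    rw [integral_add (((hdep.comp Real.cos).integrable hX).const_mul _) (hi.const_mul _),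
      integral_const_mul, integral_const_mul, hs, ih]
    ring

lemma one_sub_cos_le_abs (y : ℝ) : 1 - Real.cos y ≤ |y| := by
  rcases le_total |y| 2 with h | h
  · have := Real.one_sub_sq_div_two_le_cos (x := y)
    nlinarith [sq_abs y, abs_nonneg y]
  · linarith [Real.neg_one_le_cos y]

/-- A characteristic function bounded away from `1` forces spread, through `1 - cos y ≤ |y|`.
Nothing is assumed on the law of the starting value `W`, so the bound is available in every round.
-/
lemma le_integral_abs_walk (hX : ∀ i, Measurable (X i)) (hlaw : ∀ i, μ.map (X i) = fairCoin)
    (hind : iIndepFun X μ) (hT : ∀ j, T j ⊆ T (j + 1)) (hp : ∀ j, p j ∈ T (j + 1))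
    (hp' : ∀ j, p j ∉ T j) (hW : DependsOnSamples X (T 0) W) (hδ : 0 ≤ δ)
    (J : ℕ) :
    δ * √J / 4 ≤ ∫ ω, |W ω - δ * ∑ j ∈ Finset.range J, boolSign (X (p j) ω)| ∂μ := by
  rcases hδ.eq_or_lt with rfl | hδ
  · simpa using integral_nonneg fun ω => abs_nonneg (W ω)
  rcases J.eq_zero_or_pos with rfl | hJ
  · simpa using integral_nonneg fun ω => abs_nonneg (W ω)
  have hJ' : (0 : ℝ) < √J := by positivity
  -- The frequency is the inverse of the standard deviation of the walk.
  set θ : ℝ := 1 / (δ * √J) with hθ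
  have hθ0 : 0 < θ := by positivity
  have hθδ : θ * δ = 1 / √J := by rw [hθ]; field_simp
  have hW' : DependsOnSamples X (T 0) fun ω => θ * W ω := hW.comp (θ * ·)
  have hcos := integral_cos_walk hX hlaw hind hT hp hp' hW' (θ * δ) J
  have hdep := dependsOnSamples_walk hT hp hW δ J
  have hdep' := dependsOnSamples_walk hT hp hW' (θ * δ) J
  have h1 : ∫ ω, Real.cos (θ * W ω - θ * δ * ∑ j ∈ Finset.range J, boolSign (X (p j) ω)) ∂μ
      ≤ 3 / 4 := by
    have hle : ∫ ω, Real.cos (θ * W ω) ∂μ ≤ 1 := by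
      have := integral_mono ((hW'.comp Real.cos).integrable (μ := μ) hX) (integrable_const 1)
        fun ω => Real.cos_le_one (θ * W ω)
      simpa using this
    have hpi := Real.pi_gt_three
    have hc0 : 0 ≤ Real.cos (1 / √J) := by
      have h1 : 1 / √(J : ℝ) ≤ 1 := by
        rw [div_le_one (by positivity)]; exact Real.one_le_sqrt.2 (by exact_mod_cast hJ)
      exact Real.cos_nonneg_of_mem_Icc ⟨by linarith [show 0 ≤ 1 / √(J : ℝ) by positivity],
        by linarith⟩
    rw [hcos, hθδ]
    calc _ ≤ Real.cos (1 / √J) ^ J * 1 := by gcongr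
      _ ≤ 3 / 4 := by rw [mul_one]; exact cos_pow_inv_sqrt_le hJ
  have h2 : ∫ ω, (1 - Real.cos (θ * W ω
        - θ * δ * ∑ j ∈ Finset.range J, boolSign (X (p j) ω))) ∂μ
      ≤ ∫ ω, θ * |W ω - δ * ∑ j ∈ Finset.range J, boolSign (X (p j) ω)| ∂μ := by
    refine integral_mono ((hdep'.comp fun y => 1 - Real.cos y).integrable hX)
      ((hdep.comp fun y => θ * |y|).integrable hX) fun ω => ?_
    refine (one_sub_cos_le_abs _).trans_eq ?_
    rw [mul_assoc, ← mul_sub, abs_mul, abs_of_pos hθ0]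
  rw [integral_sub (integrable_const _) ((hdep'.comp Real.cos).integrable hX),
    integral_const_mul] at h2
  simp only [integral_const, probReal_univ, one_smul] at h2
  have h3 : 1 / 4 ≤ θ * ∫ ω, |W ω - δ * ∑ j ∈ Finset.range J, boolSign (X (p j) ω)| ∂μ := by
    linarith
  rw [hθ, one_div_mul_eq_div, le_div_iff₀ (by positivity)] at h3
  linarith

/-- It rests on `√J ≥ J / √K` for `J < K`. It fails for `K = 1`, where the sum is zero; this is
where `K ≠ 1` enters. -/
lemma le_sum_sqrt {K : ℕ} (hK : 2 ≤ K) : (K : ℝ) * √K / 4 ≤ ∑ J ∈ Finset.range K, √(J : ℝ) := by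
  have hK' : (2 : ℝ) ≤ K := by exact_mod_cast hK
  have hs : 0 < √(K : ℝ) := by positivity
  have h1 : ∀ J ∈ Finset.range K, (J : ℝ) / √K ≤ √(J : ℝ) := fun J hJ => by
    rw [div_le_iff₀ hs]
    have : √(J : ℝ) ≤ √K := Real.sqrt_le_sqrt (by exact_mod_cast (Finset.mem_range.1 hJ).le)
    calc (J : ℝ) = √J * √J := (Real.mul_self_sqrt (by positivity)).symm
      _ ≤ √J * √K := by gcongr
  refine le_trans ?_ (Finset.sum_le_sum h1)
  have h2 : ∑ J ∈ Finset.range K, (J : ℝ) = K * (K - 1) / 2 := by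
    clear h1 hs hK' hK
    induction K with
    | zero => simp
    | succ K ih => rw [Finset.sum_range_succ, ih]; push_cast; ring
  rw [← Finset.sum_div, h2, le_div_iff₀ hs]
  have := Real.mul_self_sqrt (show (0 : ℝ) ≤ K by positivity)
  calc (K : ℝ) * √K / 4 * √K = K * (√K * √K) / 4 := by ring
    _ = K * K / 4 := by rw [this]
    _ ≤ _ := by nlinarith

/-! ### Drift of the mean within one round -/

/-- Summing `δ√J/4 ≤ A J + P * ∑ A j` over `J < K` costs at most `P * K ≤ 1` extra copies of the
total, hence a factor `2`. -/
lemma le_sum_integral_abs_skewIterate (hX : ∀ i, Measurable (X i))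
    (hlaw : ∀ i, μ.map (X i) = fairCoin) (hind : iIndepFun X μ) (hT : ∀ j, T j ⊆ T (j + 1))
    (hp : ∀ j, p j ∈ T (j + 1)) (hp' : ∀ j, p j ∉ T j) (hW : DependsOnSamples X (T 0) W)
    (hδ : 0 ≤ δ) (hP : 0 ≤ P) {K : ℕ} (hK : 2 ≤ K) (hPK : P * K ≤ 1) :
    δ * (K * √K) / 32 ≤ ∑ j ∈ Finset.range K,
      ∫ ω, |skewIterate P δ (fun j => boolSign (X (p j) ω)) (W ω) j| ∂μ := by
  set A : ℕ → ℝ := fun j =>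
    ∫ ω, |skewIterate P δ (fun j => boolSign (X (p j) ω)) (W ω) j| ∂μ with hA
  have hA0 (j : ℕ) : 0 ≤ A j := integral_nonneg fun ω => abs_nonneg _
  have hint (j : ℕ) : Integrable
      (fun ω => |skewIterate P δ (fun j => boolSign (X (p j) ω)) (W ω) j|) μ :=
    ((dependsOnSamples_skewIterate hT hp hW j).comp fun y : ℝ => |y|).integrable hX
  have h1 (J : ℕ) : δ * √J / 4 ≤ A J + P * ∑ j ∈ Finset.range J, A j := by
    refine (le_integral_abs_walk hX hlaw hind hT hp hp' hW hδ J).trans ?_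
    rw [← integral_finsetSum _ fun j _ => hint j, ← integral_const_mul,
      ← integral_add (hint J) ((integrable_finsetSum _ fun j _ => hint j).const_mul P)]
    exact integral_mono (((dependsOnSamples_walk hT hp hW δ J).comp fun y : ℝ => |y|).integrable hX)
      ((hint J).add ((integrable_finsetSum _ fun j _ => hint j).const_mul P))
      fun ω => abs_walk_le_skewIterate hP _ _ J
  set Q := ∑ j ∈ Finset.range K, A j with hQ
  have hQ0 : 0 ≤ Q := Finset.sum_nonneg fun j _ => hA0 j
  have h2 : ∑ J ∈ Finset.range K, δ * √(J : ℝ) / 4 ≤ ∑ J ∈ Finset.range K, (A J + P * Q) := by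
    refine Finset.sum_le_sum fun J hJ => (h1 J).trans ?_
    gcongr
    exact Finset.sum_le_sum_of_subset_of_nonneg
      (Finset.range_subset_range.2 (Finset.mem_range.1 hJ).le) fun j _ _ => hA0 j
  rw [Finset.sum_add_distrib, Finset.sum_const, Finset.card_range, nsmul_eq_mul,
    ← Finset.sum_div, ← Finset.mul_sum, ← hQ] at h2
  have h3 := le_sum_sqrt hK
  have h4 : δ * ((K : ℝ) * √K / 4) ≤ δ * ∑ J ∈ Finset.range K, √(J : ℝ) := by gcongr
  have h5 : (K : ℝ) * (P * Q) ≤ Q := by nlinarith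
  linarith

/-- The noise has mean zero, and `u - P * skewForce u = (1 - 3/4 P) u + (P/4) |u|`; the absolute
value is the source of the bias. -/
lemma integral_skewIterate_succ (hX : ∀ i, Measurable (X i))
    (hlaw : ∀ i, μ.map (X i) = fairCoin) (hind : iIndepFun X μ) (hT : ∀ j, T j ⊆ T (j + 1))
    (hp : ∀ j, p j ∈ T (j + 1)) (hp' : ∀ j, p j ∉ T j) (hW : DependsOnSamples X (T 0) W) (J : ℕ) :
    ∫ ω, skewIterate P δ (fun j => boolSign (X (p j) ω)) (W ω) (J + 1) ∂μ
      = (1 - 3 / 4 * P) * ∫ ω, skewIterate P δ (fun j => boolSign (X (p j) ω)) (W ω) J ∂μ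
        + P / 4 * ∫ ω, |skewIterate P δ (fun j => boolSign (X (p j) ω)) (W ω) J| ∂μ := by
  have hdep := dependsOnSamples_skewIterate (P := P) (δ := δ) hT hp hW J
  have hs := (DependsOnSamples.const (X := X) (S := T J) (1 : ℝ)).integral_mul_boolSign
    hX hlaw hind (hp' J)
  have hsi := ((DependsOnSamples.sample (X := X) (hp J)).comp
    fun b => δ * boolSign b).integrable (μ := μ) hX
  simp only [one_mul] at hs
  rw [← integral_const_mul, ← integral_const_mul, ← integral_add
    ((hdep.integrable hX).const_mul _) (((hdep.comp fun y : ℝ => |y|).integrable hX).const_mul _)]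
  have : ∫ ω, δ * boolSign (X (p J) ω) ∂μ = 0 := by rw [integral_const_mul, hs, mul_zero]
  rw [← sub_zero (∫ ω, _ + _ ∂μ), ← this, ← integral_sub _ hsi]
  · refine integral_congr_ae (.of_forall fun ω => ?_)
    simp only [skewIterate, skewForce]
    ring
  · exact ((hdep.integrable hX).const_mul _).add
      (((hdep.comp fun y : ℝ => |y|).integrable hX).const_mul _)

lemma le_of_linear_recursion {m A : ℕ → ℝ} {a b : ℝ} (ha : 0 ≤ a) (ha1 : a ≤ 1) (hb : 0 ≤ b)
    (hA : ∀ j, 0 ≤ A j) (hm : ∀ j, m (j + 1) = a * m j + b * A j) (K : ℕ) :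
    a ^ K * m 0 + a ^ K * (b * ∑ j ∈ Finset.range K, A j) ≤ m K := by
  induction K with
  | zero => simp
  | succ K ih =>
    rw [hm, Finset.sum_range_succ, pow_succ]
    have h1 : a ^ K * a * (b * A K) ≤ b * A K :=
      mul_le_of_le_one_left (mul_nonneg hb (hA K)) (mul_le_one₀ (pow_le_one₀ ha ha1) ha ha1)
    nlinarith [mul_le_mul_of_nonneg_left ih ha]

lemma integral_skewIterate_ge (hX : ∀ i, Measurable (X i))
    (hlaw : ∀ i, μ.map (X i) = fairCoin) (hind : iIndepFun X μ) (hT : ∀ j, T j ⊆ T (j + 1))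
    (hp : ∀ j, p j ∈ T (j + 1)) (hp' : ∀ j, p j ∉ T j) (hW : DependsOnSamples X (T 0) W)
    (hP : 0 ≤ P) (hP1 : P ≤ 1) (K : ℕ) :
    (1 - 3 / 4 * P) ^ K * ∫ ω, W ω ∂μ
      + (1 - 3 / 4 * P) ^ K * (P / 4 * ∑ j ∈ Finset.range K,
        ∫ ω, |skewIterate P δ (fun j => boolSign (X (p j) ω)) (W ω) j| ∂μ)
      ≤ ∫ ω, skewIterate P δ (fun j => boolSign (X (p j) ω)) (W ω) K ∂μ :=
  le_of_linear_recursion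
    (m := fun K => ∫ ω, skewIterate P δ (fun j => boolSign (X (p j) ω)) (W ω) K ∂μ)
    (by linarith) (by linarith) (by linarith)
    (fun j => integral_nonneg fun ω => abs_nonneg _)
    (integral_skewIterate_succ hX hlaw hind hT hp hp' hW) K

lemma integral_skewIterate_nonneg (hX : ∀ i, Measurable (X i))
    (hlaw : ∀ i, μ.map (X i) = fairCoin) (hind : iIndepFun X μ) (hT : ∀ j, T j ⊆ T (j + 1))
    (hp : ∀ j, p j ∈ T (j + 1)) (hp' : ∀ j, p j ∉ T j) (hW : DependsOnSamples X (T 0) W)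
    (hP : 0 ≤ P) (hP1 : P ≤ 1) (hW0 : 0 ≤ ∫ ω, W ω ∂μ) (K : ℕ) :
    0 ≤ ∫ ω, skewIterate P δ (fun j => boolSign (X (p j) ω)) (W ω) K ∂μ := by
  refine le_trans ?_ (integral_skewIterate_ge hX hlaw hind hT hp hp' hW hP hP1 K)
  have h0 : 0 ≤ (1 - 3 / 4 * P) ^ K := pow_nonneg (by linarith) K
  have h1 : 0 ≤ ∑ j ∈ Finset.range K,
      ∫ ω, |skewIterate P δ (fun j => boolSign (X (p j) ω)) (W ω) j| ∂μ :=
    Finset.sum_nonneg fun j _ => integral_nonneg fun ω => abs_nonneg _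
  positivity

lemma integral_skewIterate_drift (hX : ∀ i, Measurable (X i))
    (hlaw : ∀ i, μ.map (X i) = fairCoin) (hind : iIndepFun X μ) (hT : ∀ j, T j ⊆ T (j + 1))
    (hp : ∀ j, p j ∈ T (j + 1)) (hp' : ∀ j, p j ∉ T j) (hW : DependsOnSamples X (T 0) W)
    (hδ : 0 ≤ δ) (hP : 0 ≤ P) {K : ℕ} (hK : 2 ≤ K) (hPK : P * K ≤ 1) :
    (1 - 3 / 4 * P) ^ K * ∫ ω, W ω ∂μ + P * K * (δ * √K / 512)
      ≤ ∫ ω, skewIterate P δ (fun j => boolSign (X (p j) ω)) (W ω) K ∂μ := by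
  have hK' : (2 : ℝ) ≤ K := by exact_mod_cast hK
  have hP1 : P ≤ 1 := by nlinarith
  refine le_trans ?_ (integral_skewIterate_ge hX hlaw hind hT hp hp' hW hP hP1 K)
  -- Bernoulli with `P * K ≤ 1`. The constant of the drift is then `512 = 4 * 4 * 32`.
  have h1 : 1 / 4 ≤ (1 - 3 / 4 * P) ^ K := by
    have := one_add_mul_le_pow (a := -(3 / 4 * P)) (by linarith) K
    rw [← sub_eq_add_neg] at this
    nlinarith
  have h2 := le_sum_integral_abs_skewIterate hX hlaw hind hT hp hp' hW hδ hP hK hPK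
  have h3 : (1 / 4) * (P / 4 * (δ * (K * √K) / 32)) ≤ (1 - 3 / 4 * P) ^ K * (P / 4 *
      ∑ j ∈ Finset.range K,
        ∫ ω, |skewIterate P δ (fun j => boolSign (X (p j) ω)) (W ω) j| ∂μ) := by
    gcongr
  linarith

end Walk

/-! ### Local steps in coordinates -/

section Coordinates

variable (L l r η : ℝ) (s : ℕ → Bool) (x : Vec 3) (j : ℕ)

lemma localIterate_hardLoss_zero :
    localIterate η (stochGrad (hardLoss L l r)) s x j 0 = (1 - η * L) ^ j * x 0 := by
  induction j with
  | zero => simp [localIterate]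
  | succ j ih =>
    rw [localIterate, stochGrad_hardLoss, PiLp.sub_apply, PiLp.smul_apply, ih, pow_succ]
    simp; ring

lemma localIterate_hardLoss_one :
    localIterate η (stochGrad (hardLoss L l r)) s x (j + 1) 1
      = (1 - η * l) * localIterate η (stochGrad (hardLoss L l r)) s x j 1
        - η * r * boolSign (s j) := by
  rw [localIterate, stochGrad_hardLoss, PiLp.sub_apply, PiLp.smul_apply]
  simp; ring

lemma localIterate_hardLoss_two :
    localIterate η (stochGrad (hardLoss L l r)) s x j 2
      = skewIterate (η * L / 4) (η * r) (fun j => boolSign (s j)) (x 2) j := by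
  induction j with
  | zero => rfl
  | succ j ih =>
    rw [localIterate, stochGrad_hardLoss, PiLp.sub_apply, PiLp.smul_apply, skewIterate, ← ih]
    simp; ring

end Coordinates

/-! ### Which samples an iterate depends on -/

/-- The indices of the samples drawn before the `j`-th local step of round `t`. -/
def pastSamples (n K t j : ℕ) : Finset (ℕ × Fin n × ℕ) :=
  Finset.range t ×ˢ Finset.univ ×ˢ Finset.range K ∪ {t} ×ˢ Finset.univ ×ˢ Finset.range j

section Past

variable {n K t j : ℕ} (i : Fin n)

lemma mem_pastSamples {p : ℕ × Fin n × ℕ} :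
    p ∈ pastSamples n K t j ↔ (p.1 < t ∧ p.2.2 < K) ∨ (p.1 = t ∧ p.2.2 < j) := by
  simp only [pastSamples, Finset.mem_union, Finset.mem_product, Finset.mem_range,
    Finset.mem_univ, Finset.mem_singleton, true_and]

lemma pastSamples_subset_succ : pastSamples n K t j ⊆ pastSamples n K t (j + 1) := by
  intro p; simp only [mem_pastSamples]; omega

lemma pastSamples_subset_next : pastSamples n K t K ⊆ pastSamples n K (t + 1) 0 := by
  intro p; simp only [mem_pastSamples]; omega

lemma mem_pastSamples_succ : (t, i, j) ∈ pastSamples n K t (j + 1) := by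
  simp [mem_pastSamples]

lemma notMem_pastSamples : (t, i, j) ∉ pastSamples n K t j := by
  simp [mem_pastSamples]

end Past

section Dependence

variable {d n : ℕ} {Ω : Type*} (ξ : ℕ → Fin n → ℕ → Ω → Bool) (g : Vec d → Bool → Vec d) (η : ℝ)
  (K : ℕ) (x0 : Vec d)

/-- The samples as a family over one index type. -/
def sampleFamily (p : ℕ × Fin n × ℕ) : Ω → Bool := ξ p.1 p.2.1 p.2.2

/-- The random global iterate. -/
noncomputable def randomIterate (t : ℕ) (ω : Ω) : Vec d :=
  iterate η K g (fun t i j => ξ t i j ω) x0 t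

/-- The random local iterate. -/
noncomputable def randomLocal (t : ℕ) (i : Fin n) (j : ℕ) (ω : Ω) : Vec d :=
  localIterate η g (fun j => ξ t i j ω) (randomIterate ξ g η K x0 t ω) j

lemma randomIterate_succ (t : ℕ) (ω : Ω) : randomIterate ξ g η K x0 (t + 1) ω
    = (1 / (n : ℝ)) • ∑ i, randomLocal ξ g η K x0 t i K ω := rfl

lemma randomIterate_succ_apply (t : ℕ) (ω : Ω) (k : Fin d) : randomIterate ξ g η K x0 (t + 1) ω k
    = (1 / (n : ℝ)) * ∑ i, randomLocal ξ g η K x0 t i K ω k := by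
  simp [randomIterate_succ]

variable {ξ g η K x0}

lemma dependsOnSamples_randomLocal_of {t : ℕ}
    (h : DependsOnSamples (sampleFamily ξ) (pastSamples n K t 0) (randomIterate ξ g η K x0 t))
    (i : Fin n) (j : ℕ) :
    DependsOnSamples (sampleFamily ξ) (pastSamples n K t j) (randomLocal ξ g η K x0 t i j) := by
  induction j with
  | zero => exact h
  | succ j ih =>
    exact (ih.mono pastSamples_subset_succ).comp₂
      (DependsOnSamples.sample (X := sampleFamily ξ) (mem_pastSamples_succ i))
      fun z b => z - η • g z b

lemma dependsOnSamples_randomIterate (t : ℕ) :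
    DependsOnSamples (sampleFamily ξ) (pastSamples n K t 0) (randomIterate ξ g η K x0 t) := by
  induction t with
  | zero => exact .const x0
  | succ t ih =>
    exact (DependsOnSamples.sum (W := fun i => randomLocal ξ g η K x0 t i K) fun i _ =>
      (dependsOnSamples_randomLocal_of ih i K).mono pastSamples_subset_next).comp
        fun v => (1 / (n : ℝ)) • v

lemma dependsOnSamples_randomLocal (t : ℕ) (i : Fin n) (j : ℕ) :
    DependsOnSamples (sampleFamily ξ) (pastSamples n K t j) (randomLocal ξ g η K x0 t i j) :=
  dependsOnSamples_randomLocal_of (dependsOnSamples_randomIterate t) i j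

variable [MeasurableSpace Ω] {μ : Measure Ω} (hξ : IsIIDSample fairCoin μ ξ)
include hξ

lemma IsIIDSample.measurable_sampleFamily (p : ℕ × Fin n × ℕ) : Measurable (sampleFamily ξ p) :=
  hξ.measurable _ _ _

lemma IsIIDSample.map_sampleFamily (p : ℕ × Fin n × ℕ) : μ.map (sampleFamily ξ p) = fairCoin :=
  hξ.law _ _ _

lemma IsIIDSample.iIndepFun_sampleFamily : iIndepFun (sampleFamily ξ) μ := hξ.indep

end Dependence

/-! ### The stiff coordinate -/

section Stiff

variable {n : ℕ} {Ω : Type*} {ξ : ℕ → Fin n → ℕ → Ω → Bool} {L l r η : ℝ} {K : ℕ} {x0 : Vec 3}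

lemma randomIterate_stiff (hn : 0 < n) (t : ℕ) (ω : Ω) :
    randomIterate ξ (stochGrad (hardLoss L l r)) η K x0 t ω 0
      = (1 - η * L) ^ (t * K) * x0 0 := by
  have hn' : (n : ℝ) ≠ 0 := by positivity
  induction t with
  | zero => simp [randomIterate, iterate]
  | succ t ih =>
    simp only [randomIterate_succ_apply, randomLocal, localIterate_hardLoss_zero, ih,
      Finset.sum_const, Finset.card_univ, Fintype.card_fin, nsmul_eq_mul]
    rw [add_mul, one_mul, pow_add]
    field_simp

end Stiff

/-! ### The flat coordinate: exact second moment -/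

section Flat

variable {n : ℕ} {Ω : Type*} [MeasurableSpace Ω] {μ : Measure Ω} [IsProbabilityMeasure μ]
  {ξ : ℕ → Fin n → ℕ → Ω → Bool} {L l r η : ℝ} {K : ℕ} {x0 : Vec 3}

lemma integral_sq_sub_average_boolSign (hn : 0 < n) (hξ : IsIIDSample fairCoin μ ξ) {t j : ℕ}
    {W : Ω → ℝ} (hW : DependsOnSamples (sampleFamily ξ) (pastSamples n K t j) W) (a δ : ℝ) :
    ∫ ω, (a * W ω - δ * (1 / (n : ℝ) * ∑ i, boolSign (ξ t i j ω))) ^ 2 ∂μ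
      = a ^ 2 * ∫ ω, W ω ^ 2 ∂μ + δ ^ 2 / n := by
  have hX := hξ.measurable_sampleFamily
  have hb (i : Fin n) : DependsOnSamples (sampleFamily ξ) (pastSamples n K t (j + 1))
      fun ω => boolSign (ξ t i j ω) :=
    (DependsOnSamples.sample (X := sampleFamily ξ) (mem_pastSamples_succ i)).comp boolSign
  have hWi (i : Fin n) : ∫ ω, W ω * boolSign (ξ t i j ω) ∂μ = 0 :=
    hW.integral_mul_boolSign hX hξ.map_sampleFamily hξ.iIndepFun_sampleFamily
      (notMem_pastSamples i)
  have hbb (i i' : Fin n) :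
      ∫ ω, boolSign (ξ t i j ω) * boolSign (ξ t i' j ω) ∂μ = if i = i' then 1 else 0 := by
    split_ifs with h
    · subst h
      simp [← pow_two, boolSign_sq]
    · refine DependsOnSamples.integral_mul_boolSign (S := {(t, i, j)}) (p := (t, i', j)) hX
        hξ.map_sampleFamily hξ.iIndepFun_sampleFamily
        ((DependsOnSamples.sample (X := sampleFamily ξ)
          (Finset.mem_singleton_self (t, i, j))).comp boolSign) ?_
      simpa [eq_comm] using h
  have hiW (i : Fin n) : Integrable (fun ω => W ω * boolSign (ξ t i j ω)) μ :=
    ((hW.mono pastSamples_subset_succ).comp₂ (hb i) (· * ·)).integrable hX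
  have hibb (i i' : Fin n) :
      Integrable (fun ω => boolSign (ξ t i j ω) * boolSign (ξ t i' j ω)) μ :=
    ((hb i).comp₂ (hb i') (· * ·)).integrable hX
  have hpt (ω : Ω) : (a * W ω - δ * (1 / (n : ℝ) * ∑ i, boolSign (ξ t i j ω))) ^ 2
      = a ^ 2 * W ω ^ 2 - 2 * a * δ / n * (∑ i, W ω * boolSign (ξ t i j ω))
        + δ ^ 2 / n ^ 2 * ∑ i, ∑ i', boolSign (ξ t i j ω) * boolSign (ξ t i' j ω) := by
    rw [← Finset.mul_sum, ← Finset.sum_mul_sum]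
    ring
  have hI1 : Integrable (fun ω => a ^ 2 * W ω ^ 2) μ :=
    (hW.comp fun w => a ^ 2 * w ^ 2).integrable hX
  have hI2 : Integrable
      (fun ω => 2 * a * δ / n * (∑ i, W ω * boolSign (ξ t i j ω))) μ :=
    (integrable_finsetSum _ fun i _ => hiW i).const_mul _
  have hI3 : Integrable (fun ω => δ ^ 2 / n ^ 2 *
      ∑ i, ∑ i', boolSign (ξ t i j ω) * boolSign (ξ t i' j ω)) μ :=
    (integrable_finsetSum _ fun i _ => integrable_finsetSum _ fun i' _ => hibb i i').const_mul _
  simp only [hpt]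
  rw [integral_add (by exact hI1.sub hI2) hI3, integral_sub hI1 hI2, integral_const_mul,
    integral_const_mul, integral_const_mul, integral_finsetSum _ fun i _ => hiW i,
    integral_finsetSum _ fun i _ => integrable_finsetSum _ fun i' _ => hibb i i']
  simp only [integral_finsetSum _ fun i' _ => hibb _ i', hWi, hbb]
  have hn' : (n : ℝ) ≠ 0 := by positivity
  simp
  field_simp

/-- The second moment of the flat coordinate after `s` local steps. -/
noncomputable def flatMoment (a v y : ℝ) (s : ℕ) : ℝ :=
  a ^ s * y ^ 2 + v * ∑ k ∈ Finset.range s, a ^ k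

lemma flatMoment_succ (a v y : ℝ) (s : ℕ) :
    flatMoment a v y (s + 1) = a * flatMoment a v y s + v := by
  rw [flatMoment, flatMoment, geom_sum_succ]; ring

/-- The step is affine in this coordinate, so the average over workers obeys the same recursion with
averaged noise of variance `(η * r) ^ 2 / n`, even between communications. -/
lemma integral_flat_average_sq (hn : 0 < n) (hξ : IsIIDSample fairCoin μ ξ) (t : ℕ)
    (h : ∫ ω, randomIterate ξ (stochGrad (hardLoss L l r)) η K x0 t ω 1 ^ 2 ∂μ
      = flatMoment ((1 - η * l) ^ 2) ((η * r) ^ 2 / n) (x0 1) (t * K)) (j : ℕ) :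
    ∫ ω, (1 / (n : ℝ) * ∑ i, randomLocal ξ (stochGrad (hardLoss L l r)) η K x0 t i j ω 1) ^ 2 ∂μ
      = flatMoment ((1 - η * l) ^ 2) ((η * r) ^ 2 / n) (x0 1) (t * K + j) := by
  have hn' : (n : ℝ) ≠ 0 := by positivity
  induction j with
  | zero =>
    rw [add_zero, ← h]
    simp only [randomLocal, localIterate, Finset.sum_const, Finset.card_univ, Fintype.card_fin,
      nsmul_eq_mul]
    field_simp
  | succ j ih =>
    have hW : DependsOnSamples (sampleFamily ξ) (pastSamples n K t j) fun ω => 1 / (n : ℝ) *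
        ∑ i, randomLocal ξ (stochGrad (hardLoss L l r)) η K x0 t i j ω 1 :=
      (DependsOnSamples.sum
        (W := fun i ω => randomLocal ξ (stochGrad (hardLoss L l r)) η K x0 t i j ω 1)
        fun i _ => (dependsOnSamples_randomLocal t i j).comp fun z : Vec 3 => z 1).comp
          fun y => 1 / (n : ℝ) * y
    rw [← add_assoc, flatMoment_succ, ← ih,
      ← integral_sq_sub_average_boolSign hn hξ hW (1 - η * l) (η * r)]
    refine integral_congr_ae (.of_forall fun ω => ?_)
    simp only [randomLocal, localIterate_hardLoss_one, Finset.sum_sub_distrib, ← Finset.mul_sum]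
    ring

lemma integral_flat_sq (hn : 0 < n) (hξ : IsIIDSample fairCoin μ ξ) (t : ℕ) :
    ∫ ω, randomIterate ξ (stochGrad (hardLoss L l r)) η K x0 t ω 1 ^ 2 ∂μ
      = flatMoment ((1 - η * l) ^ 2) ((η * r) ^ 2 / n) (x0 1) (t * K) := by
  induction t with
  | zero => simp [randomIterate, iterate, flatMoment]
  | succ t ih =>
    simp only [randomIterate_succ_apply]
    rw [integral_flat_average_sq hn hξ t ih K, add_mul, one_mul]

end Flat

/-! ### The skew coordinate across rounds -/

section Skew

variable {n : ℕ} {Ω : Type*} [MeasurableSpace Ω] {μ : Measure Ω} [IsProbabilityMeasure μ]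
  {ξ : ℕ → Fin n → ℕ → Ω → Bool} {L l r η : ℝ} {K : ℕ} {x0 : Vec 3}

lemma skewIterate_add (P δ : ℝ) (s : ℕ → ℝ) (w : ℝ) (a j : ℕ) :
    skewIterate P δ s w (a + j)
      = skewIterate P δ (fun i => s (a + i)) (skewIterate P δ s w a) j := by
  induction j with
  | zero => rfl
  | succ j ih => rw [← add_assoc, skewIterate, skewIterate, ih]

lemma integral_skew_succ_ge (hn : 0 < n) (hξ : IsIIDSample fairCoin μ ξ) (t : ℕ) {b : ℝ}
    (h : ∀ i, b ≤ ∫ ω, randomLocal ξ (stochGrad (hardLoss L l r)) η K x0 t i K ω 2 ∂μ) :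
    b ≤ ∫ ω, randomIterate ξ (stochGrad (hardLoss L l r)) η K x0 (t + 1) ω 2 ∂μ := by
  simp only [randomIterate_succ_apply]
  rw [integral_const_mul, integral_finsetSum _ fun i _ =>
    ((dependsOnSamples_randomLocal t i K).comp fun z : Vec 3 => z 2).integrable
      hξ.measurable_sampleFamily]
  have h1 := Finset.sum_le_sum fun i (_ : i ∈ Finset.univ) => h i
  simp only [Finset.sum_const, Finset.card_univ, Fintype.card_fin, nsmul_eq_mul] at h1
  rw [one_div_mul_eq_div, le_div_iff₀ (by positivity)]
  linarith

/-- With `β = η * r * √K / 512`, a round maps a mean `m` to at least `ρ * m + P * K * β`. Since `1 -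
ρ ≤ P * K`, this dominates the recursion with fixed point `β`. -/
lemma integral_skew_drift (hn : 0 < n) (hξ : IsIIDSample fairCoin μ ξ) (hδ : 0 ≤ η * r)
    (hP : 0 ≤ η * L / 4) (hK : 2 ≤ K) (hPK : η * L / 4 * K ≤ 1) (hx0 : x0 2 = 0) (t : ℕ) :
    η * r * √K / 512 * (1 - ((1 - 3 / 4 * (η * L / 4)) ^ K) ^ t)
      ≤ ∫ ω, randomIterate ξ (stochGrad (hardLoss L l r)) η K x0 t ω 2 ∂μ := by
  set P := η * L / 4
  have hK' : (2 : ℝ) ≤ K := by exact_mod_cast hK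
  have hP1 : P ≤ 1 := by nlinarith
  set ρ := (1 - 3 / 4 * P) ^ K with hρ
  have hρ0 : 0 ≤ ρ := pow_nonneg (by linarith) K
  have hρ1 : 1 - ρ ≤ P * K := by
    have := one_add_mul_le_pow (a := -(3 / 4 * P)) (by linarith) K
    rw [← sub_eq_add_neg] at this
    nlinarith
  have hβ : 0 ≤ η * r * √K / 512 := by positivity
  induction t with
  | zero => simp [randomIterate, iterate, hx0]
  | succ t ih =>
    refine integral_skew_succ_ge hn hξ t fun i => ?_
    have h := integral_skewIterate_drift (T := fun j => pastSamples n K t j)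
      (p := fun j => (t, i, j)) (μ := μ) (P := P) (δ := η * r)
      (W := fun ω => randomIterate ξ (stochGrad (hardLoss L l r)) η K x0 t ω 2)
      hξ.measurable_sampleFamily hξ.map_sampleFamily hξ.iIndepFun_sampleFamily
      (fun j => pastSamples_subset_succ) (fun j => mem_pastSamples_succ i)
      (fun j => notMem_pastSamples i)
      ((dependsOnSamples_randomIterate t).comp fun z : Vec 3 => z 2) hδ hP hK hPK
    simp only [randomLocal, localIterate_hardLoss_two]
    refine le_trans ?_ h
    have h1 := mul_le_mul_of_nonneg_left ih hρ0
    have h2 := mul_le_mul_of_nonneg_right hρ1 hβ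
    rw [pow_succ]
    linarith

lemma integral_skew_nonneg (hn : 0 < n) (hξ : IsIIDSample fairCoin μ ξ)
    (hP : 0 ≤ η * L / 4) (hP1 : η * L / 4 ≤ 1) (hx0 : x0 2 = 0) (t : ℕ) :
    0 ≤ ∫ ω, randomIterate ξ (stochGrad (hardLoss L l r)) η K x0 t ω 2 ∂μ := by
  induction t with
  | zero => simp [randomIterate, iterate, hx0]
  | succ t ih =>
    refine integral_skew_succ_ge hn hξ t fun i => ?_
    simp only [randomLocal, localIterate_hardLoss_two]
    exact integral_skewIterate_nonneg (T := fun j => pastSamples n K t j)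
      (p := fun j => (t, i, j)) (μ := μ)
      hξ.measurable_sampleFamily hξ.map_sampleFamily hξ.iIndepFun_sampleFamily
      (fun j => pastSamples_subset_succ) (fun j => mem_pastSamples_succ i)
      (fun j => notMem_pastSamples i)
      ((dependsOnSamples_randomIterate t).comp fun z : Vec 3 => z 2) hP hP1 ih K

/-- When `P * K > 1` the one-round drift bound does not apply to the whole round. The mean is still
nonnegative after the first `K - k` local steps, so the last `k` steps are treated as a round of
their own. -/
lemma integral_skew_last_window (hn : 0 < n) (hξ : IsIIDSample fairCoin μ ξ) (hδ : 0 ≤ η * r)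
    (hP : 0 ≤ η * L / 4) {k : ℕ} (hk : 2 ≤ k) (hkK : k ≤ K) (hPk : η * L / 4 * k ≤ 1)
    (hx0 : x0 2 = 0) (t : ℕ) :
    η * L / 4 * k * (η * r * √k / 512)
      ≤ ∫ ω, randomIterate ξ (stochGrad (hardLoss L l r)) η K x0 (t + 1) ω 2 ∂μ := by
  have hk' : (2 : ℝ) ≤ k := by exact_mod_cast hk
  have hP1 : η * L / 4 ≤ 1 := by nlinarith
  obtain ⟨a, rfl⟩ := Nat.exists_eq_add_of_le' hkK
  refine integral_skew_succ_ge hn hξ t fun i => ?_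
  have hdep : DependsOnSamples (sampleFamily ξ) (pastSamples n (a + k) t 0)
      fun ω => randomIterate ξ (stochGrad (hardLoss L l r)) η (a + k) x0 t ω 2 :=
    (dependsOnSamples_randomIterate t).comp fun z : Vec 3 => z 2
  have h0 := integral_skewIterate_nonneg (T := fun j => pastSamples n (a + k) t j)
    (p := fun j => (t, i, j)) (μ := μ) (P := η * L / 4) (δ := η * r)
    hξ.measurable_sampleFamily hξ.map_sampleFamily hξ.iIndepFun_sampleFamily
    (fun j => pastSamples_subset_succ) (fun j => mem_pastSamples_succ i)
    (fun j => notMem_pastSamples i) hdep hP hP1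
    (integral_skew_nonneg hn hξ hP hP1 hx0 t) a
  have hdep' := dependsOnSamples_skewIterate (T := fun j => pastSamples n (a + k) t j)
    (p := fun j => (t, i, j)) (P := η * L / 4) (δ := η * r)
    (fun j => pastSamples_subset_succ) (fun j => mem_pastSamples_succ i) hdep a
  have h := integral_skewIterate_drift (T := fun j => pastSamples n (a + k) t (a + j))
    (p := fun j => (t, i, a + j)) (μ := μ)
    hξ.measurable_sampleFamily hξ.map_sampleFamily hξ.iIndepFun_sampleFamily
    (fun j => pastSamples_subset_succ) (fun j => mem_pastSamples_succ i)
    (fun j => notMem_pastSamples i) hdep' hδ hP hk hPk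
  simp only [randomLocal, localIterate_hardLoss_two, skewIterate_add]
  refine le_trans ?_ h
  exact le_add_of_nonneg_left (mul_nonneg (pow_nonneg (by linarith) k) h0)

end Skew

/-! ### Constraints on the step size and the number of steps -/

section Reals

variable {L B ε σ η : ℝ}

/-- Otherwise `|1 - η * L| ≥ 1` and the error stays at least `9/50 * L * B ^ 2`, far above `ε`. -/
lemma stepSize_bounds (hL : 0 < L) (hB : 0 < B) (hε : 0 < ε) (hεL : ε ≤ 1 / 512 * (L * B ^ 2))
    {T : ℕ} (h : L / 2 * ((1 - η * L) ^ T * (3 / 5 * B)) ^ 2 ≤ ε) : 0 < η ∧ η * L < 2 := by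
  have hLB : 0 < L * B ^ 2 := by positivity
  by_contra hcon
  have habs : 1 ≤ (1 - η * L) ^ 2 := by
    by_cases h0 : 0 < η
    · have : 2 ≤ η * L := not_lt.1 fun h2 => hcon ⟨h0, h2⟩
      nlinarith
    · have : η * L ≤ 0 := mul_nonpos_of_nonpos_of_nonneg (not_lt.1 h0) hL.le
      nlinarith
  have h1 : 1 ≤ ((1 - η * L) ^ T) ^ 2 := by
    rw [← pow_mul, mul_comm T 2, pow_mul]; exact one_le_pow₀ habs
  rw [mul_pow] at h
  have h2 : L / 2 * (1 * (3 / 5 * B) ^ 2) ≤ ε :=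
    le_trans (by gcongr) h
  nlinarith

lemma steps_bounds_of_flatMoment (hB : 0 < B) (hε : 0 < ε) {n T : ℕ} (hn : 0 < n) (hη : 0 < η)
    (hq : η * (16 * ε / B ^ 2) ≤ 1)
    (h : 16 * ε / B ^ 2 / 2 * flatMoment ((1 - η * (16 * ε / B ^ 2)) ^ 2)
      ((η * (σ / 2)) ^ 2 / n) (4 / 5 * B) T ≤ ε) :
    B ^ 2 ≤ 32 * η * ε * T ∧ 3 * (η * σ ^ 2) ≤ 64 * n * ε := by
  have hn' : (0 : ℝ) < n := by exact_mod_cast hn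
  set l := 16 * ε / B ^ 2 with hl
  have hl0 : 0 < l := by positivity
  have hlB : l * B ^ 2 = 16 * ε := by rw [hl]; field_simp
  set q := η * l with hqdef
  have hq0 : 0 < q := by positivity
  set G := ∑ k ∈ Finset.range T, ((1 - q) ^ 2) ^ k with hG
  have hG0 : 0 ≤ G := Finset.sum_nonneg fun k _ => by positivity
  set v := (η * (σ / 2)) ^ 2 / n with hv
  have hv0 : 0 ≤ v := by positivity
  have ha0 : 0 ≤ ((1 - q) ^ 2) ^ T := by positivity
  rw [flatMoment, mul_add] at h
  have hterm1 : l / 2 * (((1 - q) ^ 2) ^ T * (4 / 5 * B) ^ 2)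
      = 128 / 25 * ε * ((1 - q) ^ 2) ^ T := by
    linear_combination (8 / 25 * ((1 - q) ^ 2) ^ T) * hlB
  rw [hterm1] at h
  have hterm2 : 0 ≤ l / 2 * (v * G) := by positivity
  -- The curvature `l` makes the initial flat error `128/25 * ε`, which must shrink to `ε`, and
  -- `25/128 < 1/4`.
  have haT : ((1 - q) ^ 2) ^ T ≤ 1 / 4 := by
    by_contra hc
    have : ε * (1 / 4) ≤ ε * ((1 - q) ^ 2) ^ T := by gcongr; exact (not_le.1 hc).le
    nlinarith
  constructor
  · have h1 : (1 - q) ^ T ≤ 1 / 2 := by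
      rw [← pow_mul, mul_comm, pow_mul] at haT
      have : 0 ≤ (1 - q) ^ T := pow_nonneg (by linarith) T
      nlinarith
    have h2 := one_add_mul_le_pow (a := -q) (by linarith) T
    rw [← sub_eq_add_neg] at h2
    have h3 : 1 / 2 ≤ T * q := by linarith
    have h4 : 1 / 2 * B ^ 2 ≤ T * q * B ^ 2 := by gcongr
    have h5 : T * q * B ^ 2 = T * η * (16 * ε) := by rw [hqdef, ← hlB]; ring
    linarith
  · have hgeom : (1 - (1 - q) ^ 2) * G = 1 - ((1 - q) ^ 2) ^ T := by
      rw [hG, mul_neg_geom_sum]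
    -- The contraction is at most `1/4`, so `(2 * q - q ^ 2) * G ≥ 3/4`: the noise is already near
    -- its stationary level.
    have hqG : 3 / 8 ≤ q * G := by nlinarith [mul_nonneg (sq_nonneg q) hG0]
    have h1 : l / 2 * (v * G) ≤ ε := by nlinarith
    have h2 : l / 2 * (v * G) = η * σ ^ 2 / (8 * n) * (q * G) := by
      rw [hv, hqdef]; field_simp; ring
    rw [h2] at h1
    have h3 : η * σ ^ 2 / (8 * n) * (3 / 8) ≤ ε := le_trans (by gcongr) h1
    rw [div_mul_eq_mul_div, div_le_iff₀ (by positivity)] at h3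
    linarith

lemma one_sub_pow_le_half {x : ℝ} (hx0 : 0 ≤ x) (hx1 : x ≤ 1) {T : ℕ} (h : 1 ≤ T * x) :
    (1 - x) ^ T ≤ 1 / 2 := by
  have h1 := one_add_mul_le_pow (a := x) (by linarith) T
  have h2 : (1 - x) ^ T * (1 + x) ^ T ≤ 1 := by
    rw [← mul_pow]
    exact pow_le_one₀ (mul_nonneg (by linarith) (by linarith)) (by nlinarith)
  have h3 : 0 ≤ (1 - x) ^ T := pow_nonneg (by linarith) T
  nlinarith

/-- Lower bounds on the number of steps, combined into a lower bound on the running time. -/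
lemma time_ge {h τ : ℝ} {n K R : ℕ} (hn : 0 < n) (hε : 0 < ε) (hh : 0 ≤ h) (hτ : 0 ≤ τ)
    (h1 : L * B ^ 2 ≤ 64 * ε * (R * K))
    (h2 : σ ^ 2 * B ^ 2 ≤ 1024 * n * ε ^ 2 * (R * K))
    (h3 : L * σ ^ 2 * B ^ 4 ≤ 2 ^ 36 * ε ^ 3 * (K * R ^ 2) ∨
      σ ^ 2 * B ^ 2 ≤ 2 ^ 30 * ε ^ 2 * (R * K)) :
    1 / 2 ^ 31 * min
      (√(τ * h * (L * σ ^ 2 * B ^ 4 / ε ^ 3))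
        + h * (L * B ^ 2 / ε + σ ^ 2 * B ^ 2 / (n * ε ^ 2)))
      (h * (L * B ^ 2 / ε + σ ^ 2 * B ^ 2 / ε ^ 2)) ≤ R * (K * h + τ) := by
  have hn' : (0 : ℝ) < n := by exact_mod_cast hn
  have hT : (0 : ℝ) ≤ R * K := by positivity
  have hτR : 0 ≤ τ * R := by positivity
  have hhT : 0 ≤ h * (R * K) := by positivity
  have e1 : L * B ^ 2 / ε ≤ 64 * (R * K) := by
    rw [div_le_iff₀ hε]; linarith
  have e2 : σ ^ 2 * B ^ 2 / (n * ε ^ 2) ≤ 1024 * (R * K) := by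
    rw [div_le_iff₀ (by positivity)]; linarith
  rcases h3 with h3 | h3
  · have e3 : L * σ ^ 2 * B ^ 4 / ε ^ 3 ≤ 2 ^ 36 * (K * R ^ 2) := by
      rw [div_le_iff₀ (by positivity)]; linarith
    have e4 : √(τ * h * (L * σ ^ 2 * B ^ 4 / ε ^ 3)) ≤ 2 ^ 18 * (h * (R * K) + τ * R) := by
      refine Real.sqrt_le_iff.2 ⟨by positivity, ?_⟩
      have : τ * h * (L * σ ^ 2 * B ^ 4 / ε ^ 3) ≤ τ * h * (2 ^ 36 * (K * R ^ 2)) := by gcongr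
      -- The target is the product `(τ * R) * (h * (R * K))`, which is at most the square of the
      -- sum.
      nlinarith [mul_nonneg hτR hhT, sq_nonneg (h * (R * K)), sq_nonneg (τ * R)]
    have e5 : h * (L * B ^ 2 / ε + σ ^ 2 * B ^ 2 / (n * ε ^ 2)) ≤ h * (1088 * (R * K)) := by
      gcongr; linarith
    have e6 := min_le_left (√(τ * h * (L * σ ^ 2 * B ^ 4 / ε ^ 3))
        + h * (L * B ^ 2 / ε + σ ^ 2 * B ^ 2 / (n * ε ^ 2)))
      (h * (L * B ^ 2 / ε + σ ^ 2 * B ^ 2 / ε ^ 2))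
    linarith
  · have e3 : σ ^ 2 * B ^ 2 / ε ^ 2 ≤ 2 ^ 30 * (R * K) := by
      rw [div_le_iff₀ (by positivity)]; linarith
    have e5 : h * (L * B ^ 2 / ε + σ ^ 2 * B ^ 2 / ε ^ 2) ≤ h * ((64 + 2 ^ 30) * (R * K)) := by
      gcongr; linarith
    have e6 := min_le_right (√(τ * h * (L * σ ^ 2 * B ^ 4 / ε ^ 3))
        + h * (L * B ^ 2 / ε + σ ^ 2 * B ^ 2 / (n * ε ^ 2)))
      (h * (L * B ^ 2 / ε + σ ^ 2 * B ^ 2 / ε ^ 2))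
    linarith

end Reals

/-! ### From an `ε`-solution to the running time -/

lemma sq_integral_le {Ω : Type*} [MeasurableSpace Ω] {μ : Measure Ω} [IsProbabilityMeasure μ]
    {W : Ω → ℝ} (hW : Integrable W μ) (hW2 : Integrable (fun ω => W ω ^ 2) μ) :
    (∫ ω, W ω ∂μ) ^ 2 ≤ ∫ ω, W ω ^ 2 ∂μ :=
  (Even.convexOn_pow even_two).map_integral_le (continuous_pow 2).continuousOn isClosed_univ
    (.of_forall fun _ => Set.mem_univ _) hW hW2

section Solution

variable {n : ℕ} {Ω : Type*} [MeasurableSpace Ω] {μ : Measure Ω} [IsProbabilityMeasure μ]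
  {ξ : ℕ → Fin n → ℕ → Ω → Bool} {L l r η ε : ℝ} {K R : ℕ} {x0 : Vec 3}

lemma coordinates_of_isEpsSolution (hL : 0 ≤ L) (hl : 0 ≤ l) (hn : 0 < n)
    (hξ : IsIIDSample fairCoin μ ξ)
    (h : IsEpsSolution μ (hardObjective L l) 0 ε
      (randomIterate ξ (stochGrad (hardLoss L l r)) η K x0 R)) :
    L / 2 * ((1 - η * L) ^ (R * K) * x0 0) ^ 2 ≤ ε ∧
    l / 2 * flatMoment ((1 - η * l) ^ 2) ((η * r) ^ 2 / n) (x0 1) (R * K) ≤ ε ∧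
    L / 16 *
      (∫ ω, randomIterate ξ (stochGrad (hardLoss L l r)) η K x0 R ω 2 ∂μ) ^ 2 ≤ ε := by
  have hX := hξ.measurable_sampleFamily
  set x := randomIterate ξ (stochGrad (hardLoss L l r)) η K x0 R with hx
  have hdep : DependsOnSamples (sampleFamily ξ) (pastSamples n K R 0) x :=
    dependsOnSamples_randomIterate R
  have hle := h.2
  rw [hardObjective_zero, sub_zero] at hle
  have key (u : Vec 3 → ℝ) (hu : ∀ y, u y ≤ hardObjective L l y) : ∫ ω, u (x ω) ∂μ ≤ ε :=
    (integral_mono ((hdep.comp u).integrable hX) h.1 fun ω => hu (x ω)).trans hle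
  have p0 (y : Vec 3) : 0 ≤ L / 2 * y 0 ^ 2 := by positivity
  have p1 (y : Vec 3) : 0 ≤ l / 2 * y 1 ^ 2 := by positivity
  have p2 (y : Vec 3) : L / 16 * y 2 ^ 2 ≤ L / 4 * skewPotential (y 2) := by
    have := mul_le_mul_of_nonneg_left (sq_le_skewPotential (y 2)) (by positivity : 0 ≤ L / 4)
    linarith
  have p3 (y : Vec 3) : 0 ≤ L / 16 * y 2 ^ 2 := by positivity
  refine ⟨?_, ?_, ?_⟩
  · have := key (fun y => L / 2 * y 0 ^ 2) fun y => by
      unfold hardObjective; linarith [p1 y, p2 y, p3 y]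
    simpa only [hx, randomIterate_stiff hn, integral_const, probReal_univ, one_smul] using this
  · have := key (fun y => l / 2 * y 1 ^ 2) fun y => by
      unfold hardObjective; linarith [p0 y, p2 y, p3 y]
    rwa [integral_const_mul, integral_flat_sq hn hξ] at this
  · have := key (fun y => L / 16 * y 2 ^ 2) fun y => by
      unfold hardObjective; linarith [p0 y, p1 y, p2 y]
    rw [integral_const_mul] at this
    refine le_trans ?_ this
    gcongr
    exact sq_integral_le ((hdep.comp fun z : Vec 3 => z 2).integrable hX)
      ((hdep.comp fun z : Vec 3 => z 2 ^ 2).integrable hX)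

/-- If `P * K ≤ 1`, the drift over all rounds has reached half its limit by `hT`. If `P * K > 1`, a
final window of about `1 / P` steps suffices, and `L * k` is then of order `1 / η`. -/
lemma rounds_bounds_of_skew {σ : ℝ} (hn : 0 < n) (hL : 0 < L) (hσ : 0 ≤ σ) (hη : 0 < η)
    (hηL : η * L < 2) (hK : 2 ≤ K) (hR : 0 < R) (hx0 : x0 2 = 0)
    (hT : 16 ≤ 3 * (η * L) * (R * K)) (hξ : IsIIDSample fairCoin μ ξ)
    (h : L / 16 *
      (∫ ω, randomIterate ξ (stochGrad (hardLoss L l (σ / 2))) η K x0 R ω 2 ∂μ) ^ 2 ≤ ε) :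
    L * (η * σ) ^ 2 * K ≤ 2 ^ 26 * ε ∨ η * σ ^ 2 ≤ 2 ^ 25 * ε := by
  have hP : 0 < η * L / 4 := by positivity
  have hδ : 0 ≤ η * (σ / 2) := by positivity
  set m := ∫ ω, randomIterate ξ (stochGrad (hardLoss L l (σ / 2))) η K x0 R ω 2 ∂μ with hm
  have hsq (k : ℕ) (hk : η * (σ / 2) * √k / 1024 ≤ m) : L * (η * σ) ^ 2 * k ≤ 2 ^ 26 * ε := by
    have h1 : L / 16 * (η * (σ / 2) * √k / 1024) ^ 2 ≤ ε := le_trans (by gcongr) h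
    have h2 : (η * (σ / 2) * √k / 1024) ^ 2 = (η * σ) ^ 2 * k / 2 ^ 22 := by
      rw [div_pow, mul_pow, Real.sq_sqrt (by positivity)]; ring
    rw [h2] at h1
    linarith
  by_cases hPK : η * L / 4 * K ≤ 1
  · left
    refine hsq K ?_
    have h1 := integral_skew_drift (l := l) hn hξ hδ hP.le hK hPK hx0 R
    have h2 : ((1 - 3 / 4 * (η * L / 4)) ^ K) ^ R ≤ 1 / 2 := by
      rw [← pow_mul]
      refine one_sub_pow_le_half (by positivity) (by linarith) ?_
      push_cast
      linarith
    have h3 : 0 ≤ η * (σ / 2) * √K / 512 := by positivity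
    refine le_trans ?_ h1
    nlinarith
  · right
    push Not at hPK
    set P := η * L / 4 with hPdef
    set k := ⌊1 / P⌋₊ with hk
    -- The factor `L / 4` before the skew potential is used here: with `η * L < 2` the window `⌊1 /
    -- P⌋₊` has at least two steps and `P * k > 1 - P ≥ 1 / 2`.
    have hP2 : P ≤ 1 / 2 := by linarith
    have hk2 : 2 ≤ k := Nat.le_floor (by
      rw [le_div_iff₀ hP]; push_cast; linarith)
    have hkP : (k : ℝ) ≤ 1 / P := Nat.floor_le (by positivity)
    have hkK : k ≤ K := by
      have : 1 / P < K := by rw [div_lt_iff₀ hP]; linarith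
      exact_mod_cast (hkP.trans_lt this).le
    have hPk : P * k ≤ 1 := by rw [le_div_iff₀ hP] at hkP; linarith
    have hPk' : 1 / 2 ≤ P * k := by
      have := Nat.lt_floor_add_one (1 / P)
      rw [← hk, div_lt_iff₀ hP] at this
      linarith
    obtain ⟨t, rfl⟩ := Nat.exists_eq_succ_of_ne_zero hR.ne'
    have h1 := integral_skew_last_window (l := l) hn hξ hδ hP.le hk2 hkK hPk hx0 t
    have h3 : 0 ≤ η * (σ / 2) * √k / 512 := by positivity
    rw [← hPdef] at h1
    have h2 := hsq k (le_trans (by linarith [mul_le_mul_of_nonneg_right hPk' h3]) h1)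
    have h4 : L * (η * σ) ^ 2 * k = 4 * (η * σ ^ 2) * (P * k) := by rw [hPdef]; ring
    have h5 : 0 ≤ η * σ ^ 2 := by positivity
    rw [h4] at h2
    nlinarith

end Solution

/-- The worst case of the time model: every computation takes `h` and every communication `τ`. -/
def Timing.worst (n : ℕ) {h τ : ℝ} (hh : 0 ≤ h) (hτ : 0 ≤ τ) : Timing n h τ where
  comp _ _ _ := h
  comm _ := τ
  comp_nonneg _ _ _ := hh
  comp_le _ _ _ := le_rfl
  comm_nonneg _ := hτ
  comm_le _ := le_rfl

lemma Timing.runTime_worst {n : ℕ} {h τ : ℝ} (hn : 0 < n) (hh : 0 ≤ h) (hτ : 0 ≤ τ) (K R : ℕ) :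
    (Timing.worst n hh hτ).runTime K R = R * (K * h + τ) := by
  have : Nonempty (Fin n) := ⟨⟨0, hn⟩⟩
  simp [Timing.runTime, Timing.worst, mul_add]

lemma runTime_worst_ge {n : ℕ} {Ω : Type*} [MeasurableSpace Ω] {μ : Measure Ω}
    [IsProbabilityMeasure μ] {ξ : ℕ → Fin n → ℕ → Ω → Bool} {L σ B ε h τ η : ℝ} {K R : ℕ}
    (hn : 0 < n) (hL : 0 < L) (hσ : 0 ≤ σ) (hB : 0 < B) (hε : 0 < ε) (hh : 0 ≤ h) (hτ : 0 ≤ τ)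
    (hεL : ε ≤ 1 / 512 * (L * B ^ 2)) (hK : K ≠ 1) (hξ : IsIIDSample fairCoin μ ξ)
    (hsol : IsEpsSolution μ (hardObjective L (16 * ε / B ^ 2)) 0 ε
      (randomIterate ξ (stochGrad (hardLoss L (16 * ε / B ^ 2) (σ / 2))) η K (hardStart B) R)) :
    1 / 2 ^ 31 * min
      (√(τ * h * (L * σ ^ 2 * B ^ 4 / ε ^ 3))
        + h * (L * B ^ 2 / ε + σ ^ 2 * B ^ 2 / (n * ε ^ 2)))
      (h * (L * B ^ 2 / ε + σ ^ 2 * B ^ 2 / ε ^ 2)) ≤ (Timing.worst n hh hτ).runTime K R := by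
  have hn' : (0 : ℝ) < n := by exact_mod_cast hn
  obtain ⟨hstiff, hflat, hskew⟩ := coordinates_of_isEpsSolution hL.le (by positivity) hn hξ hsol
  obtain ⟨hη, hηL⟩ := stepSize_bounds hL hB hε hεL hstiff
  have hq : η * (16 * ε / B ^ 2) ≤ 1 := by
    rw [mul_div_assoc', div_le_one (by positivity)]
    have : η * ε ≤ η * (1 / 512 * (L * B ^ 2)) := by gcongr
    have : η * L * B ^ 2 ≤ 2 * B ^ 2 := by gcongr
    nlinarith [sq_nonneg B]
  obtain ⟨h1, h2⟩ := steps_bounds_of_flatMoment hB hε hn hη hq hflat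
  push_cast at h1
  have hT : (0 : ℝ) < R * K := by
    have : 0 < 32 * η * ε * (R * K) := lt_of_lt_of_le (by positivity) h1
    exact pos_of_mul_pos_right this (by positivity)
  -- Without steps the flat coordinate could not reach accuracy `ε`; with `K ≠ 1` this leaves `K ≥
  -- 2`.
  have hK0 : K ≠ 0 := by rintro rfl; simp at hT
  have hR0 : R ≠ 0 := by rintro rfl; simp at hT
  have hT16 : 16 ≤ 3 * (η * L) * (R * K) := by
    have e1 : L * B ^ 2 ≤ L * (32 * η * ε * (R * K)) := by gcongr
    have e2 : 512 * ε ≤ 32 * (η * L * (R * K)) * ε := by linarith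
    have := le_of_mul_le_mul_right e2 hε
    linarith
  have hstep : L * B ^ 2 ≤ 64 * ε * (R * K) := by
    have e1 : L * B ^ 2 ≤ L * (32 * η * ε * (R * K)) := by gcongr
    have e2 : η * L * (32 * ε * (R * K)) ≤ 2 * (32 * ε * (R * K)) := by gcongr
    linarith
  have hvar {c : ℝ} (hc : η * σ ^ 2 ≤ c * ε) : σ ^ 2 * B ^ 2 ≤ 32 * c * ε ^ 2 * (R * K) := by
    have e1 : σ ^ 2 * B ^ 2 ≤ σ ^ 2 * (32 * η * ε * (R * K)) := by gcongr
    have e2 : η * σ ^ 2 * (32 * ε * (R * K)) ≤ c * ε * (32 * ε * (R * K)) := by gcongr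
    linarith
  rw [Timing.runTime_worst hn]
  refine time_ge hn hε hh hτ hstep ?_ ?_
  · have := hvar (c := 64 / 3 * n) (by linarith)
    have h0 : 0 ≤ n * ε ^ 2 * (R * K) := by positivity
    linarith
  · refine (rounds_bounds_of_skew hn hL hσ hη hηL (by omega) (Nat.pos_of_ne_zero hR0)
      (by simp [hardStart]) hT16 hξ hskew).imp (fun h3 => ?_) fun h3 => ?_
    · have e1 : (B ^ 2) ^ 2 ≤ (32 * η * ε * (R * K)) ^ 2 := by gcongr
      have e2 : L * σ ^ 2 * (B ^ 2) ^ 2 ≤ L * σ ^ 2 * (32 * η * ε * (R * K)) ^ 2 := by gcongr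
      have e3 : L * (η * σ) ^ 2 * K * (2 ^ 10 * ε ^ 2 * (K * R ^ 2))
          ≤ 2 ^ 26 * ε * (2 ^ 10 * ε ^ 2 * (K * R ^ 2)) := by gcongr
      linarith
    · have := hvar h3
      linarith

end LocalSGD

theorem mainTheorem3 :
    ∃ c₀ : ℝ, 0 < c₀ ∧ ∃ c : ℝ, 0 < c ∧
      ∀ (n : ℕ) (L σ B ε h τ : ℝ), 0 < n → 0 < L → 0 ≤ σ → 0 < B → 0 < ε → 0 ≤ h → 0 ≤ τ →
        ε ≤ c₀ * (L * B ^ 2) →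
        ∃ (d : ℕ) (Ξ : Type) (_ : MeasurableSpace Ξ) (D : Measure Ξ) (_ : IsProbabilityMeasure D)
          (F : LocalSGD.Vec d → Ξ → ℝ) (x0 xs : LocalSGD.Vec d) (S : LocalSGD.Timing n h τ),
          LocalSGD.IsLSmooth (LocalSGD.objective D F) L ∧
          LocalSGD.HasBoundedVariance D F σ ∧
          LocalSGD.IsConvexWithMin (LocalSGD.objective D F) x0 xs B ∧
          ∀ (K R : ℕ) (η : ℝ), K ≠ 1 →
            ∀ (Ω : Type*) (_ : MeasurableSpace Ω) (μ : Measure Ω) (_ : IsProbabilityMeasure μ)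
              (ξ : ℕ → Fin n → ℕ → Ω → Ξ), LocalSGD.IsIIDSample D μ ξ →
              LocalSGD.IsEpsSolution μ (LocalSGD.objective D F) xs ε
                (fun ω => LocalSGD.iterate η K (LocalSGD.stochGrad F)
                  (fun t i j => ξ t i j ω) x0 R) →
              c * min
                  (Real.sqrt (τ * h * (L * σ ^ 2 * B ^ 4 / ε ^ 3))
                    + h * (L * B ^ 2 / ε + σ ^ 2 * B ^ 2 / (n * ε ^ 2)))
                  (h * (L * B ^ 2 / ε + σ ^ 2 * B ^ 2 / ε ^ 2))
                ≤ S.runTime K R := by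
  refine ⟨1 / 512, by norm_num, 1 / 2 ^ 31, by norm_num,
    fun n L σ B ε h τ hn hL hσ hB hε hh hτ hεL => ?_⟩
  have hl : 0 < 16 * ε / B ^ 2 := by positivity
  have hlL : 16 * ε / B ^ 2 ≤ L := by
    rw [div_le_iff₀ (by positivity)]
    have : 0 < L * B ^ 2 := by positivity
    linarith
  refine ⟨3, Bool, inferInstance, LocalSGD.fairCoin, inferInstance,
    LocalSGD.hardLoss L (16 * ε / B ^ 2) (σ / 2), LocalSGD.hardStart B, 0,
    LocalSGD.Timing.worst n hh hτ, ?_, LocalSGD.hasBoundedVariance_hardLoss ?_, ?_, ?_⟩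
  · rw [LocalSGD.objective_hardLoss]
    exact LocalSGD.isLSmooth_hardObjective hl.le hlL
  -- With `r = σ / 2` the total variance is `σ ^ 2 / 2`.
  · nlinarith [sq_nonneg σ]
  · rw [LocalSGD.objective_hardLoss]
    exact LocalSGD.isConvexWithMin_hardObjective hL hl hB.le
  · intro K R η hK Ω _ μ _ ξ hξ hsol
    rw [LocalSGD.objective_hardLoss] at hsol
    exact LocalSGD.runTime_worst_ge hn hL hσ hB hε hh hτ hεL hK hξ hsol
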